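/- Let $(V_i)_{i\ge 0}$, $(A_i)_{i\ge 0}$, $(B_i)_{i\ge 0}$ be mutually independent sequences of i.i.d. random variables, where $V_i$ is uniformly distributed on $[0,1]$, $A_i$ is exponentially distributed with rate $\lambda>0$, and $B_i\ge 0$ has finite mean. Let $W_0=w\ge 0$ be deterministic and $W_{i+1}=\max\{V_iW_i+B_i-A_i,\,0\}$ for $i\ge 0$. Write $\Phi_X(s)=\mathbb{E}\,e^{-sX}$ for the Laplace–Stieltjes transform (LST) of a nonnegative random variable $X$, and $\Phi_B$ for the LST of $B_0$. Then $W_i$ converges weakly, as $i\to\infty$, to a proper (i.e. a.s. finite) nonnegative random variable $W$. With $p_\infty=\mathbb{P}(W=0)$, for all real $s>0$ with $s\ne\lambda$, $$\Phi_W(s)=\frac{p_\infty}{s-\lambda}\left(s-\frac{\lambda\,\Phi_B(s)}{s}\int_\lambda^s\frac{u}{u-\lambda}\,\exp\left(\lambda\int_u^s\frac{\Phi_B(t)}{t(\lambda-t)}\,dt\right)du\right),$$ and $$p_\infty=\left[\int_0^\lambda\frac{1}{\lambda-u}\,\exp\left(-\int_0^u\left(\frac{\lambda\,\Phi_B(t)}{t(\lambda-t)}-\frac1t\right)dt\right)du\right]^{-1},$$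 where all the integrals converge and the integral in square brackets is strictly positive. -/

import Mathlib

open MeasureTheory ProbabilityTheory Set Filter

/-- The reflected autoregressive process `W 0 = w`, `W (i + 1) = max (V i * W i + Y i) 0`. -/
def reflectedProcess {Ω : Type*} (w : ℝ) (V Y : ℕ → Ω → ℝ) : ℕ → Ω → ℝ
  | 0 => fun _ => w
  | i + 1 => fun ω => max (V i ω * reflectedProcess w V Y i ω + Y i ω) 0

/-- The Laplace-Stieltjes transform `s ↦ 𝔼[exp (-s X)]` of a nonnegative random variable `X`,
at real arguments `s`. -/
noncomputable def lst {Ω : Type*} [MeasurableSpace Ω] (P : Measure Ω) (X : Ω → ℝ) (s : ℝ) : ℝ :=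
  ∫ ω, Real.exp (-(s * X ω)) ∂P

/-- The input of the model with uniform multipliers and exponential `A`: the sequences `V`, `A`, `B`
are each i.i.d. and independent of one another, `V i` is uniform on `[0, 1]`, `A i` is exponential
with rate `lam`, and `B i` is nonnegative with finite mean. -/
structure IsUniformExpInput {Ω : Type*} [MeasurableSpace Ω] (P : Measure Ω) (lam : ℝ)
    (V A B : ℕ → Ω → ℝ) : Prop where
  measurable_V : ∀ i, Measurable (V i)
  measurable_A : ∀ i, Measurable (A i)
  measurable_B : ∀ i, Measurable (B i)
  indep : iIndepFun (fun k : Fin 3 × ℕ => ![V, A, B] k.1 k.2) P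
  law_V : ∀ i, P.map (V i) = volume.restrict (Icc (0 : ℝ) 1)
  law_A : ∀ i, P.map (A i) = expMeasure lam
  identDistrib_B : ∀ i, IdentDistrib (B i) (B 0) P P
  nonneg_B : ∀ i, ∀ᵐ ω ∂P, 0 ≤ B i ω
  integrable_B : Integrable (B 0) P

open scoped Topology NNReal

/-! Convergence is a contraction argument. Reflection at 0 is 1-Lipschitz and `V` has mean 1/2, so
the transition operator halves Lipschitz constants. Hence `E f(W_n)`, which is the `n`-th iterate of
the operator on `f` evaluated at `w`, is Cauchy for every Lipschitz `f`
(`cauchySeq_reflectedOperator_iterate`). Taking `f = |x|` bounds the first moments, which gives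
tightness. Prokhorov's theorem then supplies a limit law `π`, and `π` is invariant.

Let `X = V W + B` with `W` distributed as `π`. Integrating out the exponential variable gives `(s -
λ) E exp(-s (X - A)⁺) = s Φ_X(λ) - λ Φ_X(s)`. Averaging over the uniform `V` gives `Φ_X(s) = Φ_B(s)
F(s) / s`, where `F(s) = ∫₀ˢ Φ_W`. By invariance, `F` solves the linear equation `(s - λ) F' = s p -
λ Φ_B F / s` with `p = Φ_X(λ)` (`stationary_equation`). Letting `s → ∞` identifies `p` as the atom
at 0 (`eq_atom`).

The equation is singular at 0 and at `λ`, and the singularities replace initial conditions. The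
integrating factor `exp(λ ∫_u^s Φ_B(t) / (t (λ - t)) dt)` vanishes as `u → λ` from the side of `s`,
so integrating from `λ` to `s` leaves no boundary constant (`integrable_and_primitive_eq`). On `(0,
λ)`, subtracting `1/t` from the kernel removes the singularity at 0. The product of `F(u)/u` with
the resulting factor falls from 1 at 0 to 0 at `λ`, which determines `p`
(`integrable_and_atom_mul_eq`). Both integrands have constant sign, so their integrability comes
with the fundamental theorem of calculus. -/

/-! ### Calculus: improper integrals and endpoint singularities. -/

theorem hasDerivAt_integral_of_continuousOn {f : ℝ → ℝ} {a x : ℝ} {U : Set ℝ}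
    (hint : IntervalIntegrable f volume a x) (hU : IsOpen U) (hx : x ∈ U)
    (hf : ContinuousOn f U) : HasDerivAt (fun u => ∫ t in a..u, f t) (f x) x :=
  intervalIntegral.integral_hasDerivAt_right hint
    (hf.stronglyMeasurableAtFilter hU x hx) (hf.continuousAt (hU.mem_nhds hx))

theorem hasDerivAt_integral_left_of_continuousOn {f : ℝ → ℝ} {x b : ℝ} {U : Set ℝ}
    (hint : IntervalIntegrable f volume x b) (hU : IsOpen U) (hx : x ∈ U)
    (hf : ContinuousOn f U) : HasDerivAt (fun u => ∫ t in u..b, f t) (-f x) x :=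
  intervalIntegral.integral_hasDerivAt_left hint
    (hf.stronglyMeasurableAtFilter hU x hx) (hf.continuousAt (hU.mem_nhds hx))

/-- A nonnegative derivative of a function with finite one-sided limits at the endpoints is
integrable, and the fundamental theorem of calculus holds. -/
theorem integrable_and_integral_eq_of_hasDerivAt_nonneg {f f' : ℝ → ℝ} {a b fa fb : ℝ}
    (hab : a < b) (hderiv : ∀ x ∈ Ioo a b, HasDerivAt f (f' x) x)
    (hnonneg : ∀ x ∈ Ioo a b, 0 ≤ f' x)
    (ha : Tendsto f (𝓝[>] a) (𝓝 fa)) (hb : Tendsto f (𝓝[<] b) (𝓝 fb)) :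
    IntervalIntegrable f' volume a b ∧ ∫ x in a..b, f' x = fb - fa := by
  have hc : ContinuousOn (extendFrom (Ioo a b) f) (Icc a b) :=
    continuousOn_Icc_extendFrom_Ioo (HasDerivAt.continuousOn hderiv) ha hb
  have hd : ∀ x ∈ Ioo a b, HasDerivAt (extendFrom (Ioo a b) f) (f' x) x := by
    intro x hx
    refine (hderiv x hx).congr_of_eventuallyEq ?_
    filter_upwards [Ioo_mem_nhds hx.1 hx.2] with y hy
    refine extendFrom_eq (subset_closure hy) ?_
    exact (hderiv y hy).continuousAt.tendsto.mono_left nhdsWithin_le_nhds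
  have hi : IntervalIntegrable f' volume a b :=
    (intervalIntegrable_iff_integrableOn_Ioc_of_le hab.le).2
      (intervalIntegral.integrableOn_deriv_of_nonneg hc hd hnonneg)
  exact ⟨hi, intervalIntegral.integral_eq_sub_of_hasDerivAt_of_tendsto hab hderiv hi ha hb⟩

/-- Comparison with `c log((b - a) / (b - u))`, which diverges as `u → b`. This is what makes the
integrating factors vanish at `λ`. -/
theorem tendsto_integral_atTop_of_inv_le {f : ℝ → ℝ} {a b c : ℝ} (hab : a < b) (hc : 0 < c)
    (hf : ContinuousOn f (Ico a b)) (hle : ∀ t ∈ Ico a b, c / (b - t) ≤ f t) :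
    Tendsto (fun u => ∫ t in a..u, f t) (𝓝[<] b) atTop := by
  have hlog : Tendsto (fun u => c * (Real.log (b - a) - Real.log (b - u))) (𝓝[<] b) atTop := by
    refine Tendsto.const_mul_atTop hc (tendsto_atTop_add_const_left _ _ ?_)
    refine tendsto_neg_atBot_atTop.comp (Real.tendsto_log_nhdsGT_zero.comp ?_)
    refine tendsto_nhdsWithin_iff.2 ⟨?_, ?_⟩
    · have : Tendsto (fun u => b - u) (𝓝 b) (𝓝 (b - b)) := by
        exact Continuous.tendsto (by fun_prop) b
      rw [sub_self] at this
      exact this.mono_left nhdsWithin_le_nhds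
    · filter_upwards [self_mem_nhdsWithin] with u hu
      exact sub_pos.2 (mem_Iio.1 hu)
  refine tendsto_atTop_mono' _ ?_ hlog
  filter_upwards [Ioo_mem_nhdsLT hab] with u hu
  have hsub : Icc a u ⊆ Ico a b := Icc_subset_Ico_right hu.2
  have hci : ContinuousOn (fun t => c / (b - t)) (Icc a u) := by
    refine continuousOn_const.div (by fun_prop) fun t ht => ?_
    exact (sub_pos.2 (hsub ht).2).ne'
  have hI : IntervalIntegrable (fun t => c / (b - t)) volume a u :=
    ContinuousOn.intervalIntegrable (by rwa [uIcc_of_le hu.1.le])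
  have heq : ∫ t in a..u, c / (b - t) = c * (Real.log (b - a) - Real.log (b - u)) := by
    rw [intervalIntegral.integral_eq_sub_of_hasDerivAt (f := fun t => -(c * Real.log (b - t)))
      (f' := fun t => c / (b - t)) _ hI]
    · ring
    · intro t ht
      rw [uIcc_of_le hu.1.le] at ht
      have hne : b - t ≠ 0 := (sub_pos.2 (hsub ht).2).ne'
      have := (((hasDerivAt_id t).const_sub b).log hne).const_mul c |>.neg
      convert! this using 1
      simp only [id]
      field_simp
  rw [← heq]
  refine intervalIntegral.integral_mono_on hu.1.le hI
    (ContinuousOn.intervalIntegrable ?_) fun t ht => hle t (hsub ht)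
  rw [uIcc_of_le hu.1.le]
  exact hf.mono hsub

theorem tendsto_integral_atTop_of_inv_le_right {f : ℝ → ℝ} {a b c : ℝ} (hab : a < b)
    (hc : 0 < c) (hf : ContinuousOn f (Ioc a b)) (hle : ∀ t ∈ Ioc a b, c / (t - a) ≤ f t) :
    Tendsto (fun u => ∫ t in u..b, f t) (𝓝[>] a) atTop := by
  have hneg : Tendsto (fun u => -u) (𝓝[>] a) (𝓝[<] (-a)) := tendsto_neg_nhdsGT
  have h := (tendsto_integral_atTop_of_inv_le (f := fun t => f (-t)) (neg_lt_neg hab) hc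
    (hf.comp (by fun_prop) fun t ht => ⟨by linarith [ht.2], by linarith [ht.1]⟩)
    (fun t ht => by
      have := hle (-t) ⟨by linarith [ht.2], by linarith [ht.1]⟩
      convert! this using 2
      ring)).comp hneg
  refine h.congr fun u => ?_
  simp [Function.comp]

/-! ### Solving the functional equation. -/

/-- The functional equation of the stationary transform `φ`, where `β` is the transform of the
input and `p` the atom at zero, with the regularity needed to solve it. -/
structure IsStationaryTransform (lam p : ℝ) (β φ : ℝ → ℝ) : Prop where
  lam_pos : 0 < lam
  p_pos : 0 < p
  continuousOn_β : ContinuousOn β (Ioi 0)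
  β_pos : ∀ t, 0 < t → 0 < β t
  exists_β_bound : ∃ m, ∀ t, 0 < t → |β t - 1| ≤ m * t
  continuousOn_φ : ContinuousOn φ (Ici 0)
  φ_zero : φ 0 = 1
  equation : ∀ s, 0 < s → s ≠ lam →
    (s - lam) * φ s = s * p - lam * β s / s * ∫ u in (0 : ℝ)..s, φ u

namespace IsStationaryTransform

variable {lam p : ℝ} {β φ : ℝ → ℝ}

theorem intervalIntegrable_φ (h : IsStationaryTransform lam p β φ) {s : ℝ} (hs : 0 ≤ s) :
    IntervalIntegrable φ volume 0 s :=
  ContinuousOn.intervalIntegrable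
    (h.continuousOn_φ.mono (by rw [uIcc_of_le hs]; exact Icc_subset_Ici_self))

theorem hasDerivAt_primitive (h : IsStationaryTransform lam p β φ) {s : ℝ} (hs : 0 < s) :
    HasDerivAt (fun x => ∫ u in (0 : ℝ)..x, φ u) (φ s) s :=
  hasDerivAt_integral_of_continuousOn (h.intervalIntegrable_φ hs.le) isOpen_Ioi hs
    (h.continuousOn_φ.mono Ioi_subset_Ici_self)

theorem continuousOn_kernel (h : IsStationaryTransform lam p β φ) :
    ContinuousOn (fun t => β t / (t * (lam - t))) (Ioi 0 \ {lam}) := by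
  refine (h.continuousOn_β.mono sdiff_subset).div (by fun_prop) fun t ht => ?_
  exact mul_ne_zero (ne_of_gt ht.1) (sub_ne_zero.2 fun e => ht.2 e.symm)

theorem isOpen_domain : IsOpen (Ioi 0 \ {lam} : Set ℝ) := isOpen_Ioi.sdiff isClosed_singleton

theorem intervalIntegrable_kernel (h : IsStationaryTransform lam p β φ) {a b : ℝ}
    (hab : uIcc a b ⊆ Ioi 0 \ {lam}) :
    IntervalIntegrable (fun t => β t / (t * (lam - t))) volume a b :=
  (h.continuousOn_kernel.mono hab).intervalIntegrable

theorem uIcc_subset_domain_of_lt {a b : ℝ} (hlam : 0 < lam) (ha : lam < a) (hb : lam < b) :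
    uIcc a b ⊆ Ioi 0 \ {lam} := fun t ht => by
  have : lam < t := (lt_min ha hb).trans_le ht.1
  exact ⟨hlam.trans this, this.ne'⟩

theorem uIcc_subset_domain_of_gt {a b : ℝ} (ha : a ∈ Ioo 0 lam) (hb : b ∈ Ioo 0 lam) :
    uIcc a b ⊆ Ioi 0 \ {lam} := fun t ht => by
  have h1 : 0 < t := (lt_min ha.1 hb.1).trans_le ht.1
  have h2 : t < lam := ht.2.trans_lt (max_lt ha.2 hb.2)
  exact ⟨h1, h2.ne⟩

theorem intervalIntegrable_kernel_of_mem_uIcc (h : IsStationaryTransform lam p β φ) {s u : ℝ}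
    (hs : 0 < s) (hne : s ≠ lam) (hu : u ∈ uIcc lam s) (hune : u ≠ lam) :
    IntervalIntegrable (fun t => β t / (t * (lam - t))) volume u s := by
  rcases hne.lt_or_gt with hlt | hlt
  · rw [uIcc_of_ge hlt.le] at hu
    exact h.intervalIntegrable_kernel (uIcc_subset_domain_of_gt
      ⟨hs.trans_le hu.1, lt_of_le_of_ne hu.2 hune⟩ ⟨hs, hlt⟩)
  · rw [uIcc_of_le hlt.le] at hu
    exact h.intervalIntegrable_kernel (uIcc_subset_domain_of_lt h.lam_pos
      (lt_of_le_of_ne hu.1 hune.symm) hlt)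

/-- By compactness. The constant is the one in the comparison of the kernel with `c / |λ - t|` near
`λ`. -/
theorem exists_pos_le_div (h : IsStationaryTransform lam p β φ) {a b : ℝ} (ha : 0 < a) :
    ∃ c, 0 < c ∧ ∀ t ∈ Icc a b, c ≤ β t / t := by
  rcases (Icc a b).eq_empty_or_nonempty with he | hn
  · exact ⟨1, one_pos, by simp [he]⟩
  have hsub : Icc a b ⊆ Ioi 0 := fun t ht => ha.trans_le ht.1
  obtain ⟨x, hx, hmin⟩ := isCompact_Icc.exists_isMinOn hn
    ((h.continuousOn_β.mono hsub).div continuousOn_id fun t ht => ne_of_gt (hsub ht))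
  exact ⟨β x / x, div_pos (h.β_pos x (hsub hx)) (hsub hx), fun t ht => hmin ht⟩

/-- The exponential is the integrating factor of the linear equation for the primitive of `φ`: the
terms containing the primitive cancel and only the source term remains. -/
theorem hasDerivAt_primitive_mul_exp (h : IsStationaryTransform lam p β φ) {s u : ℝ}
    (hu : 0 < u) (hune : u ≠ lam) (hint : uIcc u s ⊆ Ioi 0 \ {lam}) :
    HasDerivAt (fun u => (∫ t in (0 : ℝ)..u, φ t) *
        Real.exp (lam * ∫ t in u..s, β t / (t * (lam - t))))
      (p * (u / (u - lam) * Real.exp (lam * ∫ t in u..s, β t / (t * (lam - t))))) u := by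
  have hE := ((hasDerivAt_integral_left_of_continuousOn (h.intervalIntegrable_kernel hint)
    isOpen_domain ⟨hu, hune⟩ h.continuousOn_kernel).const_mul lam).exp
  refine ((h.hasDerivAt_primitive hu).mul hE).congr_deriv ?_
  have h1 : u - lam ≠ 0 := sub_ne_zero.2 hune
  have h2 : lam - u ≠ 0 := sub_ne_zero.2 hune.symm
  have hφ : φ u = (u * p - lam * β u / u * ∫ t in (0 : ℝ)..u, φ t) / (u - lam) := by
    rw [eq_div_iff h1, mul_comm]; exact h.equation u hu hune
  rw [hφ, ← neg_sub u lam]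
  field_simp
  ring

/-- To the right of `λ` the kernel is at most `-c / (t - λ)`, so the exponent tends to `-∞` while
the primitive stays bounded. -/
theorem tendsto_primitive_mul_exp_of_lt (h : IsStationaryTransform lam p β φ) {s : ℝ}
    (hs : lam < s) :
    Tendsto (fun u => (∫ t in (0 : ℝ)..u, φ t) *
      Real.exp (lam * ∫ t in u..s, β t / (t * (lam - t)))) (𝓝[>] lam) (𝓝 0) := by
  have hF := ((h.hasDerivAt_primitive h.lam_pos).continuousAt.tendsto.mono_left
    (nhdsWithin_le_nhds (s := Ioi lam)))
  obtain ⟨c, hc, hle⟩ := h.exists_pos_le_div (b := s) h.lam_pos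
  have hk := tendsto_integral_atTop_of_inv_le_right (f := fun t => -(β t / (t * (lam - t)))) hs hc
    (h.continuousOn_kernel.neg.mono fun t ht => ⟨h.lam_pos.trans ht.1, ne_of_gt ht.1⟩)
    (fun t ht => by
      have h1 := sub_pos.2 ht.1
      have : -(β t / (t * (lam - t))) = β t / t / (t - lam) := by
        rw [← div_div, ← neg_sub t lam, div_neg, neg_neg]
      rw [this]
      exact div_le_div_of_nonneg_right (hle t ⟨ht.1.le, ht.2⟩) h1.le)
  have hE := Real.tendsto_exp_atBot.comp
    (tendsto_neg_atTop_atBot.comp (hk.const_mul_atTop h.lam_pos))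
  have := hF.mul hE
  rw [mul_zero] at this
  refine this.congr fun u => ?_
  simp [Function.comp]

/-- To the left of `λ` the kernel is positive, but the integral runs backwards from `u` to `s`, so
the exponent again tends to `-∞`. -/
theorem tendsto_primitive_mul_exp_of_gt (h : IsStationaryTransform lam p β φ) {s : ℝ}
    (hs0 : 0 < s) (hs : s < lam) :
    Tendsto (fun u => (∫ t in (0 : ℝ)..u, φ t) *
      Real.exp (lam * ∫ t in u..s, β t / (t * (lam - t)))) (𝓝[<] lam) (𝓝 0) := by
  have hF := ((h.hasDerivAt_primitive h.lam_pos).continuousAt.tendsto.mono_left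
    (nhdsWithin_le_nhds (s := Iio lam)))
  obtain ⟨c, hc, hle⟩ := h.exists_pos_le_div (b := lam) hs0
  have hk := tendsto_integral_atTop_of_inv_le (f := fun t => β t / (t * (lam - t))) hs hc
    (h.continuousOn_kernel.mono fun t ht => ⟨hs0.trans_le ht.1, ne_of_lt ht.2⟩)
    (fun t ht => by
      rw [← div_div]
      exact div_le_div_of_nonneg_right (hle t ⟨ht.1, ht.2.le⟩) (sub_pos.2 ht.2).le)
  have hE := Real.tendsto_exp_atBot.comp
    (tendsto_neg_atTop_atBot.comp (hk.const_mul_atTop h.lam_pos))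
  have := hF.mul hE
  rw [mul_zero] at this
  refine this.congr fun u => ?_
  simp only [Function.comp]
  rw [intervalIntegral.integral_symm u s, mul_neg, neg_neg]

theorem integrable_and_primitive_eq (h : IsStationaryTransform lam p β φ) {s : ℝ}
    (hs : 0 < s) (hne : s ≠ lam) :
    IntervalIntegrable (fun u => u / (u - lam) *
        Real.exp (lam * ∫ t in u..s, β t / (t * (lam - t)))) volume lam s ∧
      ∫ u in (0 : ℝ)..s, φ u = p * ∫ u in lam..s, u / (u - lam) *
        Real.exp (lam * ∫ t in u..s, β t / (t * (lam - t))) := by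
  have hends : Tendsto (fun u => (∫ t in (0 : ℝ)..u, φ t) *
      Real.exp (lam * ∫ t in u..s, β t / (t * (lam - t)))) (𝓝 s)
        (𝓝 (∫ u in (0 : ℝ)..s, φ u)) := by
    have := (h.hasDerivAt_primitive_mul_exp (s := s) hs hne
      (by simpa using ⟨hs, hne⟩)).continuousAt.tendsto
    simpa using this
  rcases hne.lt_or_gt with hlt | hlt
  · have hd : ∀ x ∈ Ioo s lam, HasDerivAt (fun u => -((∫ t in (0 : ℝ)..u, φ t) *
        Real.exp (lam * ∫ t in u..s, β t / (t * (lam - t)))))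
        (-(p * (x / (x - lam) * Real.exp (lam * ∫ t in x..s, β t / (t * (lam - t)))))) x :=
      fun x hx => (h.hasDerivAt_primitive_mul_exp (hs.trans hx.1) hx.2.ne
        (uIcc_subset_domain_of_gt ⟨hs.trans hx.1, hx.2⟩ ⟨hs, hlt⟩)).neg
    obtain ⟨hi, he⟩ := integrable_and_integral_eq_of_hasDerivAt_nonneg hlt hd
      (fun x hx => by
        have h1 := h.p_pos
        have h2 : x / (x - lam) ≤ 0 :=
          div_nonpos_of_nonneg_of_nonpos (hs.trans hx.1).le (sub_nonpos.2 hx.2.le)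
        have := mul_nonpos_of_nonneg_of_nonpos h1.le
          (mul_nonpos_of_nonpos_of_nonneg h2 (Real.exp_nonneg
            (lam * ∫ t in x..s, β t / (t * (lam - t)))))
        linarith)
      (hends.mono_left nhdsWithin_le_nhds).neg (h.tendsto_primitive_mul_exp_of_gt hs hlt).neg
    rw [intervalIntegral.integral_neg, intervalIntegral.integral_const_mul,
      intervalIntegral.integral_symm] at he
    constructor
    · have := (hi.neg.const_mul p⁻¹).symm
      refine this.congr fun x _ => ?_
      have := h.p_pos.ne'
      simp [this]
    · linarith
  · obtain ⟨hi, he⟩ := integrable_and_integral_eq_of_hasDerivAt_nonneg hlt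
      (fun x hx => h.hasDerivAt_primitive_mul_exp (h.lam_pos.trans hx.1) hx.1.ne'
        (uIcc_subset_domain_of_lt h.lam_pos hx.1 hlt))
      (fun x hx => mul_nonneg h.p_pos.le (mul_nonneg
        (div_nonneg (h.lam_pos.trans hx.1).le (sub_pos.2 hx.1).le) (Real.exp_nonneg _)))
      (h.tendsto_primitive_mul_exp_of_lt hlt) (hends.mono_left nhdsWithin_le_nhds)
    rw [intervalIntegral.integral_const_mul] at he
    constructor
    · refine (hi.const_mul p⁻¹).congr fun x _ => ?_
      have := h.p_pos.ne'
      simp [this]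
    · linarith

theorem transform_eq (h : IsStationaryTransform lam p β φ) {s : ℝ}
    (hs : 0 < s) (hne : s ≠ lam) :
    φ s = p / (s - lam) * (s - lam * β s / s * ∫ u in lam..s, u / (u - lam) *
        Real.exp (lam * ∫ t in u..s, β t / (t * (lam - t)))) := by
  have h1 : s - lam ≠ 0 := sub_ne_zero.2 hne
  have h2 := h.equation s hs hne
  rw [(h.integrable_and_primitive_eq hs hne).2] at h2
  rw [div_mul_eq_mul_div, eq_div_iff h1, mul_comm, h2]
  ring

theorem continuousOn_regularizedKernel (h : IsStationaryTransform lam p β φ) :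
    ContinuousOn (fun t => lam * β t / (t * (lam - t)) - 1 / t) (Ioo 0 lam) := by
  refine ((continuousOn_const.mul (h.continuousOn_β.mono fun t ht => ht.1)).div (by fun_prop)
    fun t ht => ?_).sub (continuousOn_const.div continuousOn_id fun t ht => ne_of_gt ht.1)
  exact mul_ne_zero (ne_of_gt ht.1) (sub_pos.2 ht.2).ne'

/-- Over the common denominator `t (λ - t)` the numerator is `λ (β t - 1) + t`, which is `O(t)` by
the linear bound on `β - 1`. The singularity at 0 therefore cancels. -/
theorem intervalIntegrable_regularizedKernel (h : IsStationaryTransform lam p β φ) {u : ℝ}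
    (hu : u ∈ Ioo 0 lam) :
    IntervalIntegrable (fun t => lam * β t / (t * (lam - t)) - 1 / t) volume 0 u := by
  obtain ⟨m, hm⟩ := h.exists_β_bound
  have hlam := h.lam_pos
  rw [intervalIntegrable_iff_integrableOn_Ioc_of_le hu.1.le]
  have hsub : Ioc 0 u ⊆ Ioo 0 lam := fun t ht => ⟨ht.1, ht.2.trans_lt hu.2⟩
  refine IntegrableOn.of_bound (by simp) ((h.continuousOn_regularizedKernel.mono
    hsub).aestronglyMeasurable measurableSet_Ioc) ((lam * m + 1) / (lam - u)) ?_
  filter_upwards [ae_restrict_mem measurableSet_Ioc] with t ht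
  have h1 : 0 < lam - t := sub_pos.2 (hsub ht).2
  have h0 := ht.1
  have heq : lam * β t / (t * (lam - t)) - 1 / t = (lam * (β t - 1) + t) / (t * (lam - t)) := by
    field_simp
    ring
  have hnum : |lam * (β t - 1) + t| ≤ (lam * m + 1) * t := by
    calc |lam * (β t - 1) + t| ≤ |lam * (β t - 1)| + |t| := abs_add_le _ _
      _ = lam * |β t - 1| + t := by rw [abs_mul, abs_of_pos hlam, abs_of_pos h0]
      _ ≤ lam * (m * t) + t := by gcongr; exact hm t h0
      _ = _ := by ring
  have hm0 : 0 ≤ m := by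
    by_contra hneg
    have := (abs_nonneg _).trans (hm t h0)
    nlinarith
  rw [Real.norm_eq_abs, heq, abs_div, abs_of_pos (mul_pos h0 h1), div_le_div_iff₀ (by positivity)
    (sub_pos.2 hu.2)]
  have h2 : lam - u ≤ lam - t := by linarith [ht.2]
  have h3 : 0 ≤ (lam * m + 1) * t := by positivity
  calc |lam * (β t - 1) + t| * (lam - u) ≤ (lam * m + 1) * t * (lam - t) :=
        mul_le_mul hnum h2 (sub_pos.2 hu.2).le h3
    _ = _ := by ring

/-- The quotient is the slope of the primitive at 0, whose right derivative there is `φ 0 = 1`. This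
is where the normalization of the transform enters. -/
theorem tendsto_primitive_div (h : IsStationaryTransform lam p β φ) :
    Tendsto (fun u => (∫ t in (0 : ℝ)..u, φ t) / u) (𝓝[>] 0) (𝓝 1) := by
  have hmeas : StronglyMeasurableAtFilter φ (𝓝[Ioi 0] 0) volume :=
    ⟨Ioi 0, self_mem_nhdsWithin, (h.continuousOn_φ.mono
      Ioi_subset_Ici_self).aestronglyMeasurable measurableSet_Ioi⟩
  have hd := intervalIntegral.integral_hasDerivWithinAt_right (a := 0) (b := 0) (f := φ)
    (s := Ici 0) (t := Ioi 0) (by simp) hmeas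
    ((h.continuousOn_φ 0 self_mem_Ici).mono Ioi_subset_Ici_self)
  have := hasDerivWithinAt_iff_tendsto_slope.1 hd
  rw [h.φ_zero] at this
  simp only [Ici_sdiff_left] at this
  refine this.congr fun u => ?_
  simp [slope_def_field]

theorem hasDerivAt_regularized (h : IsStationaryTransform lam p β φ) {u : ℝ}
    (hu : u ∈ Ioo 0 lam) :
    HasDerivAt (fun u => -((∫ t in (0 : ℝ)..u, φ t) / u *
        Real.exp (-∫ t in (0 : ℝ)..u, (lam * β t / (t * (lam - t)) - 1 / t))))
      (p * (1 / (lam - u) *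
        Real.exp (-∫ t in (0 : ℝ)..u, (lam * β t / (t * (lam - t)) - 1 / t)))) u := by
  have hE := (hasDerivAt_integral_of_continuousOn (h.intervalIntegrable_regularizedKernel hu)
    isOpen_Ioo hu h.continuousOn_regularizedKernel).neg.exp
  have hG := (h.hasDerivAt_primitive hu.1).div (hasDerivAt_id u) (ne_of_gt hu.1)
  refine (hG.mul hE).neg.congr_deriv ?_
  have h0 : u ≠ 0 := ne_of_gt hu.1
  have h1 : u - lam ≠ 0 := (sub_neg.2 hu.2).ne
  have h2 : lam - u ≠ 0 := (sub_pos.2 hu.2).ne'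
  have hφ : φ u = (u * p - lam * β u / u * ∫ t in (0 : ℝ)..u, φ t) / (u - lam) := by
    rw [eq_div_iff h1, mul_comm]; exact h.equation u hu.1 hu.2.ne
  simp only [id, Pi.div_apply, Pi.neg_apply]
  rw [hφ, ← neg_sub u lam]
  field_simp
  ring

theorem tendsto_regularized_zero (h : IsStationaryTransform lam p β φ) :
    Tendsto (fun u => -((∫ t in (0 : ℝ)..u, φ t) / u *
        Real.exp (-∫ t in (0 : ℝ)..u, (lam * β t / (t * (lam - t)) - 1 / t))))
      (𝓝[>] 0) (𝓝 (-1)) := by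
  have hhalf : lam / 2 ∈ Ioo 0 lam := ⟨half_pos h.lam_pos, half_lt_self h.lam_pos⟩
  have hc := (intervalIntegral.continuousOn_primitive_interval (μ := volume)
    ((intervalIntegrable_iff').1 (h.intervalIntegrable_regularizedKernel hhalf))) 0 left_mem_uIcc
  have hI : Tendsto (fun u => ∫ t in (0 : ℝ)..u, (lam * β t / (t * (lam - t)) - 1 / t))
      (𝓝[>] 0) (𝓝 0) := by
    rw [uIcc_of_le hhalf.1.le] at hc
    have := hc.tendsto
    rw [intervalIntegral.integral_same] at this
    refine this.mono_left ?_
    rw [← nhdsWithin_Ioo_eq_nhdsGT hhalf.1]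
    exact nhdsWithin_mono _ Ioo_subset_Icc_self
  have hE := (Real.continuous_exp.tendsto _).comp hI.neg
  have := (h.tendsto_primitive_div.mul hE).neg
  simpa using this

/-- Only the part of the exponent beyond `λ/2` matters: there the singular kernel diverges, while
the subtracted `1/t` contributes a bounded amount. -/
theorem tendsto_regularized_lam (h : IsStationaryTransform lam p β φ) :
    Tendsto (fun u => -((∫ t in (0 : ℝ)..u, φ t) / u *
        Real.exp (-∫ t in (0 : ℝ)..u, (lam * β t / (t * (lam - t)) - 1 / t))))
      (𝓝[<] lam) (𝓝 0) := by
  have hlam := h.lam_pos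
  have hhalf : lam / 2 ∈ Ioo 0 lam := ⟨half_pos hlam, half_lt_self hlam⟩
  have hG : Tendsto (fun u => (∫ t in (0 : ℝ)..u, φ t) / u) (𝓝[<] lam)
      (𝓝 ((∫ t in (0 : ℝ)..lam, φ t) / lam)) :=
    (((h.hasDerivAt_primitive hlam).continuousAt.div continuousAt_id
      hlam.ne').tendsto.mono_left nhdsWithin_le_nhds)
  obtain ⟨c, hc, hle⟩ := h.exists_pos_le_div (b := lam) hhalf.1
  have hk := tendsto_integral_atTop_of_inv_le (f := fun t => β t / (t * (lam - t))) hhalf.2 hc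
    (h.continuousOn_kernel.mono fun t ht => ⟨hhalf.1.trans_le ht.1, ne_of_lt ht.2⟩)
    (fun t ht => by
      rw [← div_div]
      exact div_le_div_of_nonneg_right (hle t ⟨ht.1, ht.2.le⟩) (sub_pos.2 ht.2).le)
  have hI : Tendsto (fun u => ∫ t in (0 : ℝ)..u, (lam * β t / (t * (lam - t)) - 1 / t))
      (𝓝[<] lam) atTop := by
    set C := ∫ t in (0 : ℝ)..lam / 2, (lam * β t / (t * (lam - t)) - 1 / t)
    refine tendsto_atTop_mono' _ ?_
      (tendsto_atTop_add_const_right _ (C - 1) (hk.const_mul_atTop hlam))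
    filter_upwards [Ioo_mem_nhdsLT hhalf.2] with u hu
    have hu' : u ∈ Ioo 0 lam := ⟨hhalf.1.trans hu.1, hu.2⟩
    have hi1 := h.intervalIntegrable_kernel (uIcc_subset_domain_of_gt hhalf hu')
    have hi2 : IntervalIntegrable (fun t : ℝ => 1 / t) volume (lam / 2) u := by
      refine (continuousOn_const.div continuousOn_id fun t ht => ?_).intervalIntegrable
      exact ((lt_min hhalf.1 hu'.1).trans_le ht.1).ne'
    rw [← intervalIntegral.integral_add_adjacent_intervals
      (h.intervalIntegrable_regularizedKernel hhalf)
      ((h.intervalIntegrable_regularizedKernel hhalf).symm.trans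
        (h.intervalIntegrable_regularizedKernel hu'))]
    have heq : ∫ t in lam / 2..u, (lam * β t / (t * (lam - t)) - 1 / t) =
        lam * (∫ t in lam / 2..u, β t / (t * (lam - t))) - ∫ t in lam / 2..u, 1 / t := by
      rw [← intervalIntegral.integral_const_mul,
        ← intervalIntegral.integral_sub (hi1.const_mul lam) hi2]
      simp only [mul_div_assoc]
    -- The integrand is at most `2/λ` on an interval of length less than `λ/2`. This is the 1 in `C
    -- - 1`.
    have hlog : ∫ t in lam / 2..u, 1 / t ≤ 1 := by
      have : ∫ t in lam / 2..u, 1 / t ≤ ∫ t in lam / 2..u, 2 / lam := by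
        refine intervalIntegral.integral_mono_on hu.1.le hi2 (by simp) fun t ht => ?_
        have : 0 < t := hhalf.1.trans_le ht.1
        rw [div_le_div_iff₀ this hlam]
        linarith [ht.1]
      refine this.trans ?_
      rw [intervalIntegral.integral_const, smul_eq_mul, mul_div_assoc', div_le_one hlam]
      linarith [hu.2]
    rw [heq]
    linarith
  have hE := Real.tendsto_exp_atBot.comp (tendsto_neg_atTop_atBot.comp hI)
  have := (hG.mul hE).neg
  simpa using this

theorem integrable_and_atom_mul_eq (h : IsStationaryTransform lam p β φ) :
    IntervalIntegrable (fun u => 1 / (lam - u) *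
        Real.exp (-∫ t in (0 : ℝ)..u, (lam * β t / (t * (lam - t)) - 1 / t))) volume 0 lam ∧
      p * (∫ u in (0 : ℝ)..lam, 1 / (lam - u) *
        Real.exp (-∫ t in (0 : ℝ)..u, (lam * β t / (t * (lam - t)) - 1 / t))) = 1 := by
  obtain ⟨hi, he⟩ := integrable_and_integral_eq_of_hasDerivAt_nonneg h.lam_pos
    (fun x hx => h.hasDerivAt_regularized hx)
    (fun x hx => mul_nonneg h.p_pos.le (mul_nonneg
        (one_div_nonneg.2 (sub_pos.2 hx.2).le) (Real.exp_nonneg _)))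
    h.tendsto_regularized_zero h.tendsto_regularized_lam
  rw [intervalIntegral.integral_const_mul] at he
  constructor
  · refine (hi.const_mul p⁻¹).congr fun x _ => ?_
    have := h.p_pos.ne'
    simp [this]
  · linarith

end IsStationaryTransform

/-! ### The transition operator on Lipschitz functions. -/

/-- The transition operator of the reflected autoregression whose multiplier and increment have
joint law `ν`. -/
noncomputable def reflectedOperator (ν : Measure (ℝ × ℝ)) (f : ℝ → ℝ) (x : ℝ) : ℝ :=
  ∫ z, f (max (z.1 * x + z.2) 0) ∂ν

section Operator

variable {ν : Measure (ℝ × ℝ)} {f : ℝ → ℝ} {L c : ℝ≥0}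

theorem LipschitzWith.abs_le_add_mul_abs (hf : LipschitzWith L f) (x : ℝ) :
    |f x| ≤ |f 0| + L * |x| := by
  have := hf.dist_le_mul x 0
  rw [Real.dist_eq, Real.dist_eq, sub_zero] at this
  have h2 := abs_sub_abs_le_abs_sub (f x) (f 0)
  linarith

theorem LipschitzWith.abs_comp_reflect_le (hf : LipschitzWith L f) (x v y : ℝ) :
    |f (max (v * x + y) 0)| ≤ |f 0| + L * (|v| * |x| + |y|) := by
  refine (hf.abs_le_add_mul_abs _).trans ?_
  gcongr
  rw [← abs_mul, abs_of_nonneg (le_max_right _ _)]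
  exact max_le ((le_abs_self _).trans (abs_add_le _ _)) (by positivity)

theorem LipschitzWith.integrable_comp_reflect [IsFiniteMeasure ν] (hf : LipschitzWith L f)
    (h1 : Integrable (fun z => z.1) ν) (h2 : Integrable (fun z => z.2) ν) (x : ℝ) :
    Integrable (fun z => f (max (z.1 * x + z.2) 0)) ν := by
  have hc := hf.continuous
  refine Integrable.mono' (g := fun z => |f 0| + L * (|z.1| * |x| + |z.2|)) ?_
    (Continuous.aestronglyMeasurable (by fun_prop))
    (Eventually.of_forall fun z => hf.abs_comp_reflect_le x z.1 z.2)
  exact (integrable_const _).add (((h1.abs.mul_const _).add h2.abs).const_mul _)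

/-- Two copies driven by the same input differ after one step by at most `|V|` times their previous
distance; the average of `|V|` is at most `c`. -/
theorem LipschitzWith.lipschitzWith_reflectedOperator [IsFiniteMeasure ν] (hf : LipschitzWith L f)
    (h1 : Integrable (fun z => z.1) ν) (h2 : Integrable (fun z => z.2) ν)
    (hc : ∫ z, |z.1| ∂ν ≤ c) : LipschitzWith (L * c) (reflectedOperator ν f) := by
  refine LipschitzWith.of_dist_le_mul fun x y => ?_
  have hsub : reflectedOperator ν f x - reflectedOperator ν f y =
      ∫ z, (f (max (z.1 * x + z.2) 0) - f (max (z.1 * y + z.2) 0)) ∂ν :=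
    (integral_sub (hf.integrable_comp_reflect h1 h2 x) (hf.integrable_comp_reflect h1 h2 y)).symm
  rw [Real.dist_eq, hsub]
  calc |∫ z, (f (max (z.1 * x + z.2) 0) - f (max (z.1 * y + z.2) 0)) ∂ν|
      ≤ ∫ z, |f (max (z.1 * x + z.2) 0) - f (max (z.1 * y + z.2) 0)| ∂ν :=
        abs_integral_le_integral_abs
    _ ≤ ∫ z, L * dist x y * |z.1| ∂ν := by
        refine integral_mono ((hf.integrable_comp_reflect h1 h2 x).sub
          (hf.integrable_comp_reflect h1 h2 y)).abs (h1.abs.const_mul _) fun z => ?_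
        refine (hf.dist_le_mul _ _).trans ?_
        rw [mul_assoc]
        gcongr
        rw [Real.dist_eq]
        refine (abs_max_sub_max_le_abs _ _ _).trans ?_
        rw [add_sub_add_right_eq_sub, ← mul_sub, abs_mul, mul_comm, Real.dist_eq]
    _ = L * dist x y * ∫ z, |z.1| ∂ν := integral_const_mul _ _
    _ ≤ L * dist x y * c := by gcongr
    _ = ↑(L * c) * dist x y := by push_cast; ring

theorem LipschitzWith.lipschitzWith_reflectedOperator_iterate [IsFiniteMeasure ν]
    (hf : LipschitzWith L f)
    (h1 : Integrable (fun z => z.1) ν) (h2 : Integrable (fun z => z.2) ν)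
    (hc : ∫ z, |z.1| ∂ν ≤ c) (n : ℕ) :
    LipschitzWith (L * c ^ n) ((reflectedOperator ν)^[n] f) := by
  induction n with
  | zero => simpa using hf
  | succ n ih =>
    rw [Function.iterate_succ_apply', pow_succ, ← mul_assoc]
    exact ih.lipschitzWith_reflectedOperator h1 h2 hc

/-- Consecutive iterates differ by the mean change of the `n`-th iterate over one step of the chain
from `x`. That iterate is `L c ^ n`-Lipschitz, so the differences decay geometrically. -/
theorem LipschitzWith.cauchySeq_reflectedOperator_iterate [IsProbabilityMeasure ν]
    (hf : LipschitzWith L f) (h1 : Integrable (fun z => z.1) ν)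
    (h2 : Integrable (fun z => z.2) ν) (hc : ∫ z, |z.1| ∂ν ≤ c) (hc1 : c < 1) (x : ℝ) :
    CauchySeq fun n => (reflectedOperator ν)^[n] f x := by
  refine cauchySeq_of_le_geometric (c : ℝ) (L * ∫ z, |max (z.1 * x + z.2) 0 - x| ∂ν)
    (by exact_mod_cast hc1) fun n => ?_
  have hL := hf.lipschitzWith_reflectedOperator_iterate h1 h2 hc n
  set g := (reflectedOperator ν)^[n] f
  have hi : Integrable (fun z => max (z.1 * x + z.2) 0) ν :=
    (LipschitzWith.id (α := ℝ)).integrable_comp_reflect h1 h2 x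
  have heq : (reflectedOperator ν)^[n + 1] f x - g x =
      ∫ z, (g (max (z.1 * x + z.2) 0) - g x) ∂ν := by
    rw [Function.iterate_succ_apply', integral_sub (hL.integrable_comp_reflect h1 h2 x)
      (integrable_const _), integral_const]
    simp [reflectedOperator, g]
  rw [dist_comm, Real.dist_eq, heq]
  calc |∫ z, (g (max (z.1 * x + z.2) 0) - g x) ∂ν|
      ≤ ∫ z, |g (max (z.1 * x + z.2) 0) - g x| ∂ν := abs_integral_le_integral_abs
    _ ≤ ∫ z, L * c ^ n * |max (z.1 * x + z.2) 0 - x| ∂ν := by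
        refine integral_mono ((hL.integrable_comp_reflect h1 h2 x).sub
          (integrable_const _)).abs ((hi.sub (integrable_const _)).abs.const_mul _) fun z => ?_
        have := hL.dist_le_mul (max (z.1 * x + z.2) 0) x
        simpa [Real.dist_eq] using this
    _ = _ := by rw [integral_const_mul]; ring

end Operator

/-! ### The process: moments, tightness and the stationary limit. -/

theorem reflectedProcess_nonneg {Ω : Type*} {w : ℝ} {V Y : ℕ → Ω → ℝ} (hw : 0 ≤ w)
    (n : ℕ) (ω : Ω) :
    0 ≤ reflectedProcess w V Y n ω := by
  cases n with
  | zero => exact hw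
  | succ n => exact le_max_right _ _

section Recursion

variable {Ω : Type*} [MeasurableSpace Ω] {P : Measure Ω} {w : ℝ} {V Y : ℕ → Ω → ℝ}

theorem reflectedProcess_measurable (n : ℕ) (hV : ∀ i < n, Measurable (V i))
    (hY : ∀ i < n, Measurable (Y i)) : Measurable (reflectedProcess w V Y n) := by
  induction n with
  | zero => exact measurable_const
  | succ n ih =>
    exact (((hV n n.lt_succ_self).mul (ih (fun i hi => hV i (hi.trans n.lt_succ_self))
      fun i hi => hY i (hi.trans n.lt_succ_self))).add (hY n n.lt_succ_self)).max measurable_const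

/-- The inputs `(V i, Y i)` have common law `ν` and are independent of the past, with an
integrable increment and a multiplier of mean absolute value at most `c`. -/
structure IsReflectedInput (P : Measure Ω) (w : ℝ) (V Y : ℕ → Ω → ℝ) (ν : Measure (ℝ × ℝ))
    (c : ℝ≥0) : Prop where
  measurable_V : ∀ i, Measurable (V i)
  measurable_Y : ∀ i, Measurable (Y i)
  law : ∀ i, P.map (fun ω => (V i ω, Y i ω)) = ν
  indep : ∀ i, IndepFun (reflectedProcess w V Y i) (fun ω => (V i ω, Y i ω)) P
  integrable_fst : Integrable (fun z : ℝ × ℝ => z.1) ν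
  integrable_snd : Integrable (fun z : ℝ × ℝ => z.2) ν
  integral_abs_fst_le : ∫ z, |z.1| ∂ν ≤ c

namespace IsReflectedInput

variable {ν : Measure (ℝ × ℝ)} {c : ℝ≥0} {L : ℝ≥0} {f : ℝ → ℝ}

theorem measurable_pair (h : IsReflectedInput P w V Y ν c) (i : ℕ) :
    Measurable fun ω => (V i ω, Y i ω) := (h.measurable_V i).prodMk (h.measurable_Y i)

theorem measurable_process (h : IsReflectedInput P w V Y ν c) (i : ℕ) :
    Measurable (reflectedProcess w V Y i) :=
  reflectedProcess_measurable i (fun j _ => h.measurable_V j) fun j _ => h.measurable_Y j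

theorem integrable_V (h : IsReflectedInput P w V Y ν c) (i : ℕ) : Integrable (V i) P := by
  have := h.integrable_fst
  rw [← h.law i] at this
  exact this.comp_measurable (h.measurable_pair i)

theorem integrable_Y (h : IsReflectedInput P w V Y ν c) (i : ℕ) : Integrable (Y i) P := by
  have := h.integrable_snd
  rw [← h.law i] at this
  exact this.comp_measurable (h.measurable_pair i)

variable [IsProbabilityMeasure P]

theorem isProbabilityMeasure (h : IsReflectedInput P w V Y ν c) : IsProbabilityMeasure ν := by
  rw [← h.law 0]
  exact Measure.isProbabilityMeasure_map (h.measurable_pair 0).aemeasurable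

theorem integrable_process (h : IsReflectedInput P w V Y ν c) (n : ℕ) :
    Integrable (reflectedProcess w V Y n) P := by
  induction n with
  | zero => exact integrable_const _
  | succ n ih =>
    have hind : IndepFun (V n) (reflectedProcess w V Y n) P :=
      ((h.indep n).comp measurable_id measurable_fst).symm
    exact ((hind.integrable_mul (h.integrable_V n) ih).add (h.integrable_Y n)).sup
      (integrable_const 0)

theorem integral_succ (h : IsReflectedInput P w V Y ν c) (hf : LipschitzWith L f) (n : ℕ) :
    ∫ ω, f (reflectedProcess w V Y (n + 1) ω) ∂P =
      ∫ ω, reflectedOperator ν f (reflectedProcess w V Y n ω) ∂P := by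
  have := h.isProbabilityMeasure
  have hm := h.measurable_process n
  have hprob : IsProbabilityMeasure (P.map (reflectedProcess w V Y n)) :=
    Measure.isProbabilityMeasure_map hm.aemeasurable
  have hmap : P.map (fun ω => (reflectedProcess w V Y n ω, (V n ω, Y n ω))) =
      (P.map (reflectedProcess w V Y n)).prod ν := by
    rw [← h.law n]
    exact (indepFun_iff_map_prod_eq_prod_map_map hm.aemeasurable
      (h.measurable_pair n).aemeasurable).1 (h.indep n)
  have hcont := hf.continuous
  have hg : Continuous fun q : ℝ × ℝ × ℝ => f (max (q.2.1 * q.1 + q.2.2) 0) := by fun_prop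
  have hid : Integrable (fun x : ℝ => x) (P.map (reflectedProcess w V Y n)) :=
    (integrable_map_measure aestronglyMeasurable_id hm.aemeasurable).2 (h.integrable_process n)
  have hint : Integrable (fun q : ℝ × ℝ × ℝ => f (max (q.2.1 * q.1 + q.2.2) 0))
      ((P.map (reflectedProcess w V Y n)).prod ν) := by
    refine Integrable.mono' (g := fun q => |f 0| + L * (|q.1| * |q.2.1| + |q.2.2|)) ?_
      hg.aestronglyMeasurable (Eventually.of_forall fun q => ?_)
    · exact (integrable_const _).add (((hid.abs.mul_prod h.integrable_fst.abs).add
        (h.integrable_snd.abs.comp_snd _)).const_mul _)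
    · rw [mul_comm |q.1|]
      exact hf.abs_comp_reflect_le q.1 q.2.1 q.2.2
  calc ∫ ω, f (reflectedProcess w V Y (n + 1) ω) ∂P
      = ∫ q, f (max (q.2.1 * q.1 + q.2.2) 0)
          ∂(P.map (fun ω => (reflectedProcess w V Y n ω, (V n ω, Y n ω)))) :=
        (integral_map (hm.prodMk (h.measurable_pair n)).aemeasurable
          hg.aestronglyMeasurable).symm
    _ = ∫ x, reflectedOperator ν f x ∂(P.map (reflectedProcess w V Y n)) := by
        rw [hmap, integral_prod _ hint]
        rfl
    _ = _ := integral_map hm.aemeasurable (hf.lipschitzWith_reflectedOperator h.integrable_fst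
        h.integrable_snd h.integral_abs_fst_le).continuous.aestronglyMeasurable

theorem integral_eq_iterate (h : IsReflectedInput P w V Y ν c) (hf : LipschitzWith L f) (n : ℕ) :
    ∫ ω, f (reflectedProcess w V Y n ω) ∂P = (reflectedOperator ν)^[n] f w := by
  have := h.isProbabilityMeasure
  -- The inductive step applies the hypothesis to the image of `f` under the operator, which has
  -- another Lipschitz constant.
  induction n generalizing f L with
  | zero => simp [reflectedProcess]
  | succ n ih =>
    rw [h.integral_succ hf, ih (hf.lipschitzWith_reflectedOperator h.integrable_fst h.integrable_snd
      h.integral_abs_fst_le), Function.iterate_succ_apply]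

theorem cauchySeq_integral (h : IsReflectedInput P w V Y ν c) (hc : c < 1)
    (hf : LipschitzWith L f) :
    CauchySeq fun n => ∫ ω, f (reflectedProcess w V Y n ω) ∂P := by
  have := h.isProbabilityMeasure
  simp_rw [h.integral_eq_iterate hf]
  exact hf.cauchySeq_reflectedOperator_iterate h.integrable_fst h.integrable_snd
    h.integral_abs_fst_le hc w

/-- The Cauchy property also covers the unbounded Lipschitz function `|x|`, so first moments are
bounded and Markov's inequality applies. -/
theorem isTightMeasureSet (h : IsReflectedInput P w V Y ν c) (hc : c < 1) :
    IsTightMeasureSet (range fun n => P.map (reflectedProcess w V Y n)) := by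
  obtain ⟨C, hC⟩ := ((h.cauchySeq_integral hc
    (LipschitzWith.of_dist_le_mul (K := 1) (f := fun x : ℝ => |x|) fun x y => by
      simpa [Real.dist_eq] using abs_abs_sub_abs_le_abs_sub x y)).isBounded_range).bddAbove
  have hbound : ∀ n, ∫⁻ ω, ‖(reflectedProcess w V Y n ω)‖ₑ ∂P ≤ ENNReal.ofReal C := fun n => by
    rw [← ofReal_integral_norm_eq_lintegral_enorm (h.integrable_process n)]
    exact ENNReal.ofReal_le_ofReal (hC ⟨n, rfl⟩)
  refine isTightMeasureSet_iff_exists_isCompact_measure_compl_le.2 fun ε hε => ?_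
  obtain ⟨r, hr0, hr⟩ : ∃ r : ℝ≥0, r ≠ 0 ∧ ENNReal.ofReal C / r ≤ ε := by
    obtain ⟨δ, hδ0, hδ⟩ := ENNReal.lt_iff_exists_nnreal_btwn.1 hε
    have hδ0' : δ ≠ 0 := by simpa [pos_iff_ne_zero] using hδ0
    -- The added 1 keeps the radius nonzero when `C ≤ 0`.
    refine ⟨(C.toNNReal + 1) / δ, by positivity, le_trans ?_ hδ.le⟩
    rw [ENNReal.ofReal, ← ENNReal.coe_div (by positivity), ENNReal.coe_le_coe, div_div_eq_mul_div,
      div_le_iff₀ (by positivity), mul_comm]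
    gcongr
    exact le_self_add
  refine ⟨Metric.closedBall 0 r, isCompact_closedBall _ _, ?_⟩
  rintro _ ⟨n, rfl⟩
  refine le_trans ?_ hr
  have hm := h.measurable_process n
  rw [Measure.map_apply hm Metric.isClosed_closedBall.measurableSet.compl]
  calc P (reflectedProcess w V Y n ⁻¹' (Metric.closedBall 0 (r : ℝ))ᶜ)
      ≤ P {ω | (r : ENNReal) ≤ ‖(reflectedProcess w V Y n ω)‖ₑ} := by
        refine measure_mono fun ω hω => ?_
        simp only [mem_preimage, mem_compl_iff, Metric.mem_closedBall, dist_zero_right,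
          not_le] at hω
        rw [mem_ofPred_eq, enorm_eq_nnnorm, ENNReal.coe_le_coe, ← NNReal.coe_le_coe, coe_nnnorm]
        exact hω.le
    _ ≤ (∫⁻ ω, ‖(reflectedProcess w V Y n ω)‖ₑ ∂P) / r :=
        meas_ge_le_lintegral_div hm.enorm.aemeasurable (by simpa using hr0) (by simp)
    _ ≤ _ := by gcongr; exact hbound n

/-- The reflected autoregression converges in distribution to a stationary law. -/
theorem exists_stationary_limit (h : IsReflectedInput P w V Y ν c) (hc : c < 1) :
    ∃ (π : Measure ℝ) (_ : IsProbabilityMeasure π),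
      TendstoInDistribution (reflectedProcess w V Y) atTop (id : ℝ → ℝ) (fun _ => P) π ∧
      ∀ (f : ℝ → ℝ) (L : ℝ≥0) (C : ℝ), LipschitzWith L f → (∀ x, |f x| ≤ C) →
        ∫ x, f x ∂π = ∫ x, reflectedOperator ν f x ∂π := by
  have hν := h.isProbabilityMeasure
  have hm := fun n => (h.measurable_process n).aemeasurable (μ := P)
  let μ : ℕ → ProbabilityMeasure ℝ := fun n =>
    ⟨P.map (reflectedProcess w V Y n), Measure.isProbabilityMeasure_map (hm n)⟩
  have hcomp : IsCompact (closure (range μ)) := by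
    refine isCompact_closure_of_isTightMeasureSet ((h.isTightMeasureSet hc).subset ?_)
    rintro _ ⟨_, ⟨n, rfl⟩, rfl⟩
    exact ⟨n, rfl⟩
  obtain ⟨π, -, φ, hφ, hlim⟩ := hcomp.isSeqCompact fun n => subset_closure (mem_range_self n)
  have hint : ∀ (f : ℝ → ℝ) (L : ℝ≥0), LipschitzWith L f → ∀ n,
      ∫ x, f x ∂(μ n : Measure ℝ) = ∫ ω, f (reflectedProcess w V Y n ω) ∂P :=
    fun f L hf n => integral_map (hm n) hf.continuous.aestronglyMeasurable
  -- Integrals of Lipschitz functions converge along the whole sequence, so the subsequential limit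
  -- is the full limit.
  have hfull : Tendsto μ atTop (𝓝 π) := by
    refine tendsto_iff_forall_lipschitz_integral_tendsto.2 fun f hb hL => ?_
    have hsub := tendsto_iff_forall_lipschitz_integral_tendsto.1 hlim f hb hL
    obtain ⟨L, hL⟩ := hL
    obtain ⟨l, hl⟩ := cauchySeq_tendsto_of_complete (h.cauchySeq_integral hc hL)
    have hl' : Tendsto (fun n => ∫ x, f x ∂(μ n : Measure ℝ)) atTop (𝓝 l) :=
      hl.congr fun n => (hint f L hL n).symm
    rwa [tendsto_nhds_unique hsub (hl'.comp hφ.tendsto_atTop)]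
  refine ⟨π, inferInstance, ⟨hm, aemeasurable_id, ?_⟩, fun f L C hf hC => ?_⟩
  · have hπ : (⟨(π : Measure ℝ).map id, Measure.isProbabilityMeasure_map aemeasurable_id⟩ :
        ProbabilityMeasure ℝ) = π := Subtype.ext Measure.map_id
    rw [hπ]
    exact hfull
  · have hTL := hf.lipschitzWith_reflectedOperator h.integrable_fst h.integrable_snd
      h.integral_abs_fst_le
    have hlip := tendsto_iff_forall_lipschitz_integral_tendsto.1 hfull
    have hbdd : ∀ g : ℝ → ℝ, (∀ x, |g x| ≤ C) → ∃ C', ∀ x y, dist (g x) (g y) ≤ C' :=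
      fun g hg => ⟨C + C, fun x y => (dist_le_norm_add_norm _ _).trans
        (add_le_add (hg x) (hg y))⟩
    have hTC : ∀ x, |reflectedOperator ν f x| ≤ C := fun x => by
      have := norm_integral_le_of_norm_le_const (μ := ν)
        (f := fun z => f (max (z.1 * x + z.2) 0)) (Eventually.of_forall fun z => hC _)
      simpa [reflectedOperator] using this
    -- Invariance: the integral of `f` at time `n + 1` is that of its image under the operator at
    -- time `n`, and both converge.
    have h1 := (hlip f (hbdd f hC) ⟨L, hf⟩).comp (tendsto_add_atTop_nat 1)
    have h2 := hlip _ (hbdd _ hTC) ⟨_, hTL⟩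
    refine tendsto_nhds_unique h1 (h2.congr fun n => ?_)
    rw [Function.comp_apply, hint f L hf, hint _ _ hTL, h.integral_succ hf]

end IsReflectedInput

end Recursion

/-! ### Integration against the exponential law. -/

section Exponential

variable {lam : ℝ}

theorem integrableOn_exp_neg_mul_Ioi (hlam : 0 < lam) (a : ℝ) :
    IntegrableOn (fun x => lam * Real.exp (-(lam * x))) (Ioi a) := by
  have := (exp_neg_integrableOn_Ioi a hlam).const_mul lam
  exact this.congr (Eventually.of_forall fun x => by simp only [neg_mul])

theorem measurable_gammaPDF_one (lam : ℝ) : Measurable (gammaPDF 1 lam) :=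
  (measurable_gammaPDFReal 1 lam).ennreal_ofReal

theorem toReal_gammaPDF_smul (hlam : 0 < lam) (g : ℝ → ℝ) :
    (fun x => (gammaPDF 1 lam x).toReal • g x) =
      (Ici 0).indicator fun x => lam * Real.exp (-(lam * x)) * g x := by
  funext x
  by_cases hx : 0 ≤ x
  · rw [indicator_of_mem (mem_Ici.2 hx), gammaPDF_of_nonneg hx, ENNReal.toReal_ofReal]
    · simp
    · simpa using by positivity
  · rw [indicator_of_notMem (by simpa using hx), gammaPDF_of_neg (not_le.1 hx)]
    simp

theorem integral_expMeasure (hlam : 0 < lam) (g : ℝ → ℝ) :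
    ∫ x, g x ∂(expMeasure lam) = ∫ x in Ioi 0, lam * Real.exp (-(lam * x)) * g x := by
  rw [expMeasure, gammaMeasure, integral_withDensity_eq_integral_toReal_smul
    (measurable_gammaPDF_one lam) (by simp [gammaPDF]),
    toReal_gammaPDF_smul hlam, integral_indicator measurableSet_Ici, integral_Ici_eq_integral_Ioi]

theorem integrable_expMeasure_iff (hlam : 0 < lam) (g : ℝ → ℝ) :
    Integrable g (expMeasure lam) ↔
      IntegrableOn (fun x => lam * Real.exp (-(lam * x)) * g x) (Ioi 0) := by
  rw [expMeasure, gammaMeasure, integrable_withDensity_iff_integrable_smul'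
    (measurable_gammaPDF_one lam) (by simp [gammaPDF]),
    toReal_gammaPDF_smul hlam, integrable_indicator_iff measurableSet_Ici,
    integrableOn_Ici_iff_integrableOn_Ioi]

theorem integrable_id_expMeasure (hlam : 0 < lam) :
    Integrable (fun x => x) (expMeasure lam) := by
  rw [integrable_expMeasure_iff hlam]
  have := (integrableOn_rpow_mul_exp_neg_mul_rpow (s := 1) (by norm_num) one_pos hlam).const_mul
    lam
  refine this.congr (Eventually.of_forall fun x => ?_)
  simp only [Real.rpow_one, neg_mul]
  ring

/-- The integral splits at `a = x`: below it the reflection is inactive, above it the exponential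
equals 1. -/
theorem integral_exp_neg_reflect_expMeasure (hlam : 0 < lam) {s x : ℝ} (hs : s ≠ lam)
    (hx : 0 ≤ x) :
    ∫ a, Real.exp (-(s * max (x - a) 0)) ∂(expMeasure lam) =
      (s * Real.exp (-(lam * x)) - lam * Real.exp (-(s * x))) / (s - lam) := by
  have hne : s - lam ≠ 0 := sub_ne_zero.2 hs
  rw [integral_expMeasure hlam, ← Ioc_union_Ioi_eq_Ioi hx]
  have h1 : EqOn (fun a => lam * Real.exp (-(s * x)) * Real.exp ((s - lam) * a))
      (fun a => lam * Real.exp (-(lam * a)) * Real.exp (-(s * max (x - a) 0))) (Ioc 0 x) := by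
    intro a ha
    simp only
    rw [max_eq_left (sub_nonneg.2 ha.2), mul_assoc, mul_assoc, ← Real.exp_add, ← Real.exp_add]
    ring_nf
  have h2 : EqOn (fun a => lam * Real.exp (-(lam * a)))
      (fun a => lam * Real.exp (-(lam * a)) * Real.exp (-(s * max (x - a) 0))) (Ioi x) := by
    intro a ha
    simp only
    rw [max_eq_right (sub_nonpos.2 (mem_Ioi.1 ha).le)]
    simp
  have hi1 : IntegrableOn (fun a => lam * Real.exp (-(s * x)) * Real.exp ((s - lam) * a))
      (Ioc 0 x) := (Continuous.integrableOn_Ioc (by fun_prop))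
  have hi2 := integrableOn_exp_neg_mul_Ioi hlam x
  rw [setIntegral_union (by rw [disjoint_left]; exact fun a h h' => absurd h.2 (not_le.2 h'))
    measurableSet_Ioi (hi1.congr_fun h1 measurableSet_Ioc)
    (hi2.congr_fun h2 measurableSet_Ioi), ← setIntegral_congr_fun measurableSet_Ioc h1,
    ← setIntegral_congr_fun measurableSet_Ioi h2, integral_const_mul, integral_const_mul,
    ← intervalIntegral.integral_of_le hx]
  have h3 : ∫ a in Ioi x, Real.exp (-(lam * a)) = Real.exp (-(lam * x)) / lam := by
    have := integral_exp_mul_Ioi (neg_lt_zero.2 hlam) x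
    simpa [neg_mul] using this
  have h4 : ∫ a in (0 : ℝ)..x, Real.exp ((s - lam) * a) =
      (Real.exp ((s - lam) * x) - 1) / (s - lam) := by
    rw [intervalIntegral.integral_comp_mul_left (fun y => Real.exp y) hne, integral_exp]
    simp [div_eq_inv_mul]
  have h5 : Real.exp ((s - lam) * x) = Real.exp (s * x) * Real.exp (-(lam * x)) := by
    rw [← Real.exp_add]; ring_nf
  rw [h3, h4, h5, Real.exp_neg (s * x)]
  field_simp
  ring

end Exponential

/-! ### Laplace-Stieltjes transforms. -/

theorem abs_exp_neg_sub_exp_neg_le {a b : ℝ} (ha : 0 ≤ a) (hb : 0 ≤ b) :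
    |Real.exp (-a) - Real.exp (-b)| ≤ |a - b| := by
  wlog hab : a ≤ b generalizing a b
  · rw [abs_sub_comm, abs_sub_comm a]
    exact this hb ha (not_le.1 hab).le
  have h1 : Real.exp (-b) ≤ Real.exp (-a) := Real.exp_le_exp.2 (neg_le_neg hab)
  rw [abs_of_nonneg (sub_nonneg.2 h1), abs_of_nonpos (sub_nonpos.2 hab)]
  have h2 : Real.exp (-b) = Real.exp (-a) * Real.exp (-(b - a)) := by
    rw [← Real.exp_add]; ring_nf
  have h3 := Real.one_sub_le_exp_neg (b - a)
  have h4 : Real.exp (-a) ≤ 1 := Real.exp_le_one_iff.2 (neg_nonpos.2 ha)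
  have h5 := Real.exp_pos (-a)
  nlinarith

/-- Truncation at 0 makes `exp (-s x)` bounded and Lipschitz on all of `ℝ`, hence an admissible test
function for invariance, without changing it on the support of the stationary law. -/
theorem lipschitzWith_exp_neg_mul_max {s : ℝ} (hs : 0 ≤ s) :
    LipschitzWith s.toNNReal fun x => Real.exp (-(s * max x 0)) := by
  refine LipschitzWith.of_dist_le_mul fun x y => ?_
  rw [Real.coe_toNNReal _ hs, Real.dist_eq, Real.dist_eq]
  refine (abs_exp_neg_sub_exp_neg_le (mul_nonneg hs (le_max_right x 0))
    (mul_nonneg hs (le_max_right y 0))).trans ?_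
  rw [← mul_sub, abs_mul, abs_of_nonneg hs]
  exact mul_le_mul_of_nonneg_left (abs_max_sub_max_le_abs x y 0) hs

section Transform

variable {Ω : Type*} [MeasurableSpace Ω] {P : Measure Ω} {X : Ω → ℝ}

theorem ae_exp_neg_mul_le_one (hX : ∀ᵐ ω ∂P, 0 ≤ X ω) {s : ℝ} (hs : 0 ≤ s) :
    ∀ᵐ ω ∂P, ‖Real.exp (-(s * X ω))‖ ≤ 1 := by
  filter_upwards [hX] with ω hω
  rw [Real.norm_eq_abs, Real.abs_exp, Real.exp_le_one_iff]
  exact neg_nonpos.2 (mul_nonneg hs hω)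

theorem lst_add_mul {V B : Ω → ℝ} (hV : Measurable V) (hB : Measurable B)
    (hind : IndepFun V B P) (x s : ℝ) :
    lst P (fun ω => V ω * x + B ω) s = lst P V (s * x) * lst P B s := by
  have h := (hind.comp (φ := fun v => Real.exp (-(s * x * v))) (ψ := fun b => Real.exp (-(s * b)))
    (by fun_prop) (by fun_prop)).integral_fun_mul_eq_mul_integral (by fun_prop) (by fun_prop)
  refine Eq.trans ?_ h
  refine integral_congr_ae (Eventually.of_forall fun ω => ?_)
  simp only [Function.comp]
  rw [← Real.exp_add]
  ring_nf

theorem lst_uniform {V : Ω → ℝ} (hV : Measurable V)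
    (hlaw : P.map V = volume.restrict (Icc (0 : ℝ) 1)) (c : ℝ) :
    lst P V c = ∫ v in (0 : ℝ)..1, Real.exp (-(c * v)) := by
  rw [intervalIntegral.integral_of_le zero_le_one, ← integral_Icc_eq_integral_Ioc, ← hlaw,
    integral_map hV.aemeasurable (by fun_prop)]
  rfl

variable [IsProbabilityMeasure P]

theorem integrable_exp_neg_mul_of_nonneg (hm : Measurable X) (hX : ∀ᵐ ω ∂P, 0 ≤ X ω) {s : ℝ}
    (hs : 0 ≤ s) : Integrable (fun ω => Real.exp (-(s * X ω))) P :=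
  Integrable.of_bound (by fun_prop) 1 (ae_exp_neg_mul_le_one hX hs)

theorem lst_zero : lst P X 0 = 1 := by simp [lst]

theorem lst_pos (hm : Measurable X) (hX : ∀ᵐ ω ∂P, 0 ≤ X ω) {s : ℝ} (hs : 0 ≤ s) :
    0 < lst P X s :=
  integral_exp_pos (integrable_exp_neg_mul_of_nonneg hm hX hs)

theorem lst_le_one (hX : ∀ᵐ ω ∂P, 0 ≤ X ω) {s : ℝ} (hs : 0 ≤ s) :
    lst P X s ≤ 1 := by
  have := norm_integral_le_of_norm_le_const (ae_exp_neg_mul_le_one hX hs)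
  simp only [probReal_univ, mul_one] at this
  exact (le_abs_self _).trans this

theorem continuousOn_lst (hm : Measurable X) (hX : ∀ᵐ ω ∂P, 0 ≤ X ω) :
    ContinuousOn (lst P X) (Ici 0) :=
  continuousOn_of_dominated (bound := fun _ => 1) (fun _ _ => by fun_prop)
    (fun _ hs => ae_exp_neg_mul_le_one hX hs) (integrable_const _)
    (Eventually.of_forall fun ω => by fun_prop)

theorem abs_lst_sub_one_le (hm : Measurable X) (hX : ∀ᵐ ω ∂P, 0 ≤ X ω) (hi : Integrable X P)
    {s : ℝ} (hs : 0 ≤ s) : |lst P X s - 1| ≤ (∫ ω, X ω ∂P) * s := by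
  rw [abs_of_nonpos (sub_nonpos.2 (lst_le_one hX hs)), neg_sub]
  have : ∫ ω, (1 - s * X ω) ∂P ≤ lst P X s :=
    integral_mono ((integrable_const _).sub (hi.const_mul s))
      (integrable_exp_neg_mul_of_nonneg hm hX hs) fun ω => Real.one_sub_le_exp_neg _
  rw [integral_sub (integrable_const _) (hi.const_mul s), integral_const_mul] at this
  simp only [integral_const, probReal_univ, smul_eq_mul, mul_one] at this
  linarith

theorem tendsto_lst_atTop (hm : Measurable X) (hX : ∀ᵐ ω ∂P, 0 ≤ X ω) :
    Tendsto (lst P X) atTop (𝓝 (P.real (X ⁻¹' {0}))) := by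
  have hset : MeasurableSet (X ⁻¹' {0}) := hm (measurableSet_singleton 0)
  rw [← integral_indicator_one hset]
  refine tendsto_integral_filter_of_dominated_convergence (fun _ => 1)
    (Eventually.of_forall fun s => by fun_prop) ?_ (integrable_const _) ?_
  · filter_upwards [eventually_ge_atTop 0] with s hs
    exact ae_exp_neg_mul_le_one hX hs
  · filter_upwards [hX] with ω hω
    rcases hω.eq_or_lt with h0 | hpos
    · simp [← h0, indicator]
    · rw [indicator_of_notMem (by simpa using hpos.ne')]
      exact Real.tendsto_exp_atBot.comp (tendsto_neg_atTop_atBot.comp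
        (tendsto_id.atTop_mul_const hpos))

theorem integral_exp_neg_mul_max_sub {lam s : ℝ} (hlam : 0 < lam) (hs0 : 0 ≤ s) (hs : s ≠ lam)
    {A : Ω → ℝ} (hm : Measurable X) (hX : ∀ᵐ ω ∂P, 0 ≤ X ω) (hA : Measurable A)
    (hlaw : P.map A = expMeasure lam) (hind : IndepFun X A P) :
    ∫ ω, Real.exp (-(s * max (X ω - A ω) 0)) ∂P =
      (s * lst P X lam - lam * lst P X s) / (s - lam) := by
  have := isProbabilityMeasure_expMeasure hlam
  have hpX : IsProbabilityMeasure (P.map X) := Measure.isProbabilityMeasure_map hm.aemeasurable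
  have hmap : P.map (fun ω => (X ω, A ω)) = (P.map X).prod (expMeasure lam) := by
    rw [← hlaw]
    exact (indepFun_iff_map_prod_eq_prod_map_map hm.aemeasurable hA.aemeasurable).1 hind
  have hint : Integrable (fun q : ℝ × ℝ => Real.exp (-(s * max (q.1 - q.2) 0)))
      ((P.map X).prod (expMeasure lam)) := by
    refine Integrable.of_bound (by fun_prop) 1 (Eventually.of_forall fun q => ?_)
    rw [Real.norm_eq_abs, Real.abs_exp, Real.exp_le_one_iff]
    exact neg_nonpos.2 (mul_nonneg hs0 (le_max_right _ _))
  calc ∫ ω, Real.exp (-(s * max (X ω - A ω) 0)) ∂P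
      = ∫ q, Real.exp (-(s * max (q.1 - q.2) 0)) ∂(P.map fun ω => (X ω, A ω)) :=
        (integral_map (f := fun q : ℝ × ℝ => Real.exp (-(s * max (q.1 - q.2) 0)))
          (hm.prodMk hA).aemeasurable (by fun_prop)).symm
    _ = ∫ x, ∫ a, Real.exp (-(s * max (x - a) 0)) ∂(expMeasure lam) ∂(P.map X) := by
        rw [hmap, integral_prod _ hint]
    _ = ∫ ω, ∫ a, Real.exp (-(s * max (X ω - a) 0)) ∂(expMeasure lam) ∂P :=
        integral_map hm.aemeasurable hint.aestronglyMeasurable.integral_prod_right'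
    _ = ∫ ω, (s * Real.exp (-(lam * X ω)) - lam * Real.exp (-(s * X ω))) / (s - lam) ∂P := by
        refine integral_congr_ae ?_
        filter_upwards [hX] with ω hω
        exact integral_exp_neg_reflect_expMeasure hlam hs hω
    _ = _ := by
        rw [integral_div, integral_sub
          ((integrable_exp_neg_mul_of_nonneg hm hX hlam.le).const_mul s)
          ((integrable_exp_neg_mul_of_nonneg hm hX hs0).const_mul lam),
          integral_const_mul, integral_const_mul]
        rfl

end Transform

/-- Fubini followed by `u = s v`. The uniform multiplier thus turns the transform into its running
average, which is why a differential equation arises. -/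
theorem integral_integral_exp_neg_mul {π : Measure ℝ} [IsProbabilityMeasure π]
    (hπ : ∀ᵐ x ∂π, 0 ≤ x) {s : ℝ} (hs : 0 < s) :
    ∫ x, (∫ v in (0 : ℝ)..1, Real.exp (-(s * x * v))) ∂π =
      (∫ u in (0 : ℝ)..s, lst π id u) / s := by
  rw [← intervalIntegral_integral_swap (f := fun v x => Real.exp (-(s * x * v)))]
  · have h := intervalIntegral.integral_comp_mul_left (a := 0) (b := 1) (lst π id) hs.ne'
    rw [mul_zero, mul_one, smul_eq_mul] at h
    rw [div_eq_inv_mul, ← h]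
    refine intervalIntegral.integral_congr fun v _ => ?_
    simp only [lst, id]
    refine integral_congr_ae (Eventually.of_forall fun x => ?_)
    simp only
    ring_nf
  · have hfin : IsFiniteMeasure ((volume.restrict (uIoc (0 : ℝ) 1)).prod π) := by
      rw [uIoc_of_le zero_le_one]; infer_instance
    have hcont : Continuous (Function.uncurry fun v x : ℝ => Real.exp (-(s * x * v))) := by
      fun_prop
    refine Integrable.of_bound hcont.aestronglyMeasurable 1 ?_
    have h1 : ∀ᵐ q ∂((volume.restrict (uIoc (0 : ℝ) 1)).prod π), q.1 ∈ uIoc (0 : ℝ) 1 :=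
      Measure.quasiMeasurePreserving_fst.ae (ae_restrict_mem measurableSet_uIoc)
    have h2 : ∀ᵐ q ∂((volume.restrict (uIoc (0 : ℝ) 1)).prod π), 0 ≤ q.2 :=
      Measure.quasiMeasurePreserving_snd.ae hπ
    filter_upwards [h1, h2] with q hq1 hq2
    rw [uIoc_of_le zero_le_one] at hq1
    simp only [Function.uncurry]
    rw [Real.norm_eq_abs, Real.abs_exp, Real.exp_le_one_iff]
    exact neg_nonpos.2 (mul_nonneg (mul_nonneg hs.le hq2) hq1.1.le)

/-! ### From the independent inputs to the stationary equation. -/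

/-- Functions of disjoint blocks of independent variables are independent. -/
theorem ProbabilityTheory.iIndepFun.indepFun_of_measurable_iSup {Ω ι β γ : Type*}
    [mΩ : MeasurableSpace Ω] [mβ : MeasurableSpace β] [mγ : MeasurableSpace γ] {P : Measure Ω}
    {X : ι → Ω → ℝ} (h : iIndepFun X P) (hX : ∀ i, Measurable (X i)) {S T : Set ι}
    (hST : Disjoint S T) {f : Ω → β} {g : Ω → γ}
    (hf : Measurable[⨆ i ∈ S, MeasurableSpace.comap (X i) inferInstance] f)
    (hg : Measurable[⨆ i ∈ T, MeasurableSpace.comap (X i) inferInstance] g) :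
    IndepFun f g P := by
  rw [IndepFun_iff_Indep]
  exact indep_of_indep_of_le (indep_iSup_of_disjoint (fun i => (hX i).comap_le)
    ((iIndepFun_iff_iIndep _ _ _).1 h) hST) hf.comap_le hg.comap_le

theorem measurable_iSup_comap {Ω ι : Type*} {X : ι → Ω → ℝ} {S : Set ι} {i : ι} (hi : i ∈ S) :
    Measurable[⨆ i ∈ S, MeasurableSpace.comap (X i) inferInstance] (X i) :=
  (comap_measurable (X i)).mono (le_iSup₂ (f := fun i (_ : i ∈ S) =>
    MeasurableSpace.comap (X i) (inferInstance : MeasurableSpace ℝ)) i hi) le_rfl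

namespace IsUniformExpInput

variable {Ω : Type*} [MeasurableSpace Ω] {P : Measure Ω} {lam : ℝ} {V A B : ℕ → Ω → ℝ}

theorem measurable_input (h : IsUniformExpInput P lam V A B) (k : Fin 3 × ℕ) :
    Measurable (![V, A, B] k.1 k.2) := by
  obtain ⟨k, i⟩ := k
  fin_cases k
  exacts [h.measurable_V i, h.measurable_A i, h.measurable_B i]

theorem indepFun_process (h : IsUniformExpInput P lam V A B) (w : ℝ) (n : ℕ) :
    IndepFun (reflectedProcess w V (fun i ω => B i ω - A i ω) n)
      (fun ω => (V n ω, B n ω - A n ω)) P := by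
  have hV : ∀ (S : Set (Fin 3 × ℕ)) (i : ℕ), ((0 : Fin 3), i) ∈ S →
      Measurable[⨆ k ∈ S, MeasurableSpace.comap (![V, A, B] k.1 k.2) inferInstance] (V i) :=
    fun S i hi => measurable_iSup_comap (X := fun k : Fin 3 × ℕ => ![V, A, B] k.1 k.2) hi
  have hA : ∀ (S : Set (Fin 3 × ℕ)) (i : ℕ), ((1 : Fin 3), i) ∈ S →
      Measurable[⨆ k ∈ S, MeasurableSpace.comap (![V, A, B] k.1 k.2) inferInstance] (A i) :=
    fun S i hi => measurable_iSup_comap (X := fun k : Fin 3 × ℕ => ![V, A, B] k.1 k.2) hi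
  have hB : ∀ (S : Set (Fin 3 × ℕ)) (i : ℕ), ((2 : Fin 3), i) ∈ S →
      Measurable[⨆ k ∈ S, MeasurableSpace.comap (![V, A, B] k.1 k.2) inferInstance] (B i) :=
    fun S i hi => measurable_iSup_comap (X := fun k : Fin 3 × ℕ => ![V, A, B] k.1 k.2) hi
  refine h.indep.indepFun_of_measurable_iSup h.measurable_input (S := {k | k.2 < n})
    (T := {k | k.2 = n}) ?_ ?_ ?_
  · rw [disjoint_left]
    rintro k (hk : k.2 < n) (hk' : k.2 = n)
    exact hk.ne hk'
  -- Measurability is needed for the σ-algebra generated by the inputs with index below `n`, not for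
  -- the ambient one.
  · exact @reflectedProcess_measurable Ω (_) w V (fun i ω => B i ω - A i ω) n
      (fun i hi => hV _ i hi) (fun i hi => Measurable.sub (hB _ i hi) (hA _ i hi))
  · exact Measurable.prodMk (hV _ n rfl) (Measurable.sub (hB _ n rfl) (hA _ n rfl))

theorem indepFun_V_B (h : IsUniformExpInput P lam V A B) (i : ℕ) : IndepFun (V i) (B i) P :=
  h.indep.indepFun (i := (0, i)) (j := (2, i)) (by simp)

theorem indepFun_VB_A (h : IsUniformExpInput P lam V A B) (i : ℕ) :
    IndepFun (fun ω => (V i ω, B i ω)) (A i) P :=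
  h.indep.indepFun_prodMk h.measurable_input (0, i) (2, i) (1, i) (by simp) (by simp)

theorem indepFun_BA_V (h : IsUniformExpInput P lam V A B) (i : ℕ) :
    IndepFun (fun ω => (B i ω, A i ω)) (V i) P :=
  h.indep.indepFun_prodMk h.measurable_input (2, i) (1, i) (0, i) (by simp) (by simp)

theorem indepFun_B_A (h : IsUniformExpInput P lam V A B) (i : ℕ) : IndepFun (B i) (A i) P :=
  h.indep.indepFun (i := (2, i)) (j := (1, i)) (by simp)

theorem integrable_A (h : IsUniformExpInput P lam V A B) (hlam : 0 < lam) :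
    Integrable (A 0) P := by
  have := integrable_id_expMeasure hlam
  rw [← h.law_A 0] at this
  exact this.comp_measurable (h.measurable_A 0)

theorem ae_mem_Icc_V (h : IsUniformExpInput P lam V A B) : ∀ᵐ ω ∂P, V 0 ω ∈ Icc (0 : ℝ) 1 := by
  refine ae_of_ae_map (h.measurable_V 0).aemeasurable ?_
  rw [h.law_V]
  exact ae_restrict_mem measurableSet_Icc

theorem integral_abs_V (h : IsUniformExpInput P lam V A B) : ∫ ω, |V 0 ω| ∂P = 1 / 2 := by
  have h1 : ∫ ω, |V 0 ω| ∂P = ∫ ω, V 0 ω ∂P := by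
    refine integral_congr_ae ?_
    filter_upwards [h.ae_mem_Icc_V] with ω hω
    exact abs_of_nonneg hω.1
  have h2 : ∫ ω, V 0 ω ∂P = ∫ v, v ∂(P.map (V 0)) :=
    (integral_map (f := fun v : ℝ => v) (h.measurable_V 0).aemeasurable
      aestronglyMeasurable_id).symm
  rw [h1, h2, h.law_V, integral_Icc_eq_integral_Ioc,
    ← intervalIntegral.integral_of_le zero_le_one, integral_id]
  norm_num

variable [IsProbabilityMeasure P]

theorem identDistrib_pair (h : IsUniformExpInput P lam V A B) (i : ℕ) :
    IdentDistrib (fun ω => (V i ω, B i ω - A i ω)) (fun ω => (V 0 ω, B 0 ω - A 0 ω)) P P := by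
  have hV : IdentDistrib (V i) (V 0) P P := ⟨(h.measurable_V i).aemeasurable,
    (h.measurable_V 0).aemeasurable, by rw [h.law_V, h.law_V]⟩
  have hA : IdentDistrib (A i) (A 0) P P := ⟨(h.measurable_A i).aemeasurable,
    (h.measurable_A 0).aemeasurable, by rw [h.law_A, h.law_A]⟩
  have hsub : Measurable fun q : ℝ × ℝ => q.1 - q.2 := by fun_prop
  have hY : IdentDistrib (fun ω => B i ω - A i ω) (fun ω => B 0 ω - A 0 ω) P P :=
    ((h.identDistrib_B i).prodMk hA (h.indepFun_B_A i) (h.indepFun_B_A 0)).comp hsub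
  have hind : ∀ j, IndepFun (V j) (fun ω => B j ω - A j ω) P := fun j =>
    ((h.indepFun_BA_V j).comp hsub measurable_id).symm
  exact hV.prodMk hY (hind i) (hind 0)

theorem integrable_V (h : IsUniformExpInput P lam V A B) : Integrable (V 0) P := by
  refine Integrable.of_bound (h.measurable_V 0).aestronglyMeasurable 1 ?_
  filter_upwards [h.ae_mem_Icc_V] with ω hω
  rw [Real.norm_eq_abs, abs_of_nonneg hω.1]
  exact hω.2

theorem isReflectedInput (h : IsUniformExpInput P lam V A B) (hlam : 0 < lam) (w : ℝ) :
    IsReflectedInput P w V (fun i ω => B i ω - A i ω)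
      (P.map fun ω => (V 0 ω, B 0 ω - A 0 ω)) (1 / 2) := by
  have hm : Measurable fun ω => (V 0 ω, B 0 ω - A 0 ω) :=
    (h.measurable_V 0).prodMk ((h.measurable_B 0).sub (h.measurable_A 0))
  refine ⟨h.measurable_V, fun i => (h.measurable_B i).sub (h.measurable_A i),
    fun i => (h.identDistrib_pair i).map_eq, h.indepFun_process w, ?_, ?_, ?_⟩
  · exact (integrable_map_measure measurable_fst.aestronglyMeasurable hm.aemeasurable).2
      h.integrable_V
  · exact (integrable_map_measure measurable_snd.aestronglyMeasurable hm.aemeasurable).2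
      (h.integrable_B.sub (h.integrable_A hlam))
  · rw [integral_map hm.aemeasurable (by fun_prop), h.integral_abs_V]
    simp

theorem reflectedOperator_exp (h : IsUniformExpInput P lam V A B) (hlam : 0 < lam) {s x : ℝ}
    (hs : 0 < s) (hne : s ≠ lam) (hx : 0 ≤ x) :
    reflectedOperator (P.map fun ω => (V 0 ω, B 0 ω - A 0 ω))
        (fun x => Real.exp (-(s * max x 0))) x =
      (s * (lst P (B 0) lam * ∫ v in (0 : ℝ)..1, Real.exp (-(lam * x * v))) -
        lam * (lst P (B 0) s * ∫ v in (0 : ℝ)..1, Real.exp (-(s * x * v)))) / (s - lam) := by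
  have hm : Measurable fun ω => (V 0 ω, B 0 ω - A 0 ω) :=
    (h.measurable_V 0).prodMk ((h.measurable_B 0).sub (h.measurable_A 0))
  have hX : Measurable fun ω => V 0 ω * x + B 0 ω :=
    ((h.measurable_V 0).mul_const x).add (h.measurable_B 0)
  have hX0 : ∀ᵐ ω ∂P, 0 ≤ V 0 ω * x + B 0 ω := by
    filter_upwards [h.ae_mem_Icc_V, h.nonneg_B 0] with ω h1 h2
    exact add_nonneg (mul_nonneg h1.1 hx) h2
  have hind : IndepFun (fun ω => V 0 ω * x + B 0 ω) (A 0) P :=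
    (h.indepFun_VB_A 0).comp (φ := fun q : ℝ × ℝ => q.1 * x + q.2) (by fun_prop) measurable_id
  have key := integral_exp_neg_mul_max_sub hlam hs.le hne hX hX0 (h.measurable_A 0) (h.law_A 0)
    hind
  rw [lst_add_mul (h.measurable_V 0) (h.measurable_B 0) (h.indepFun_V_B 0),
    lst_add_mul (h.measurable_V 0) (h.measurable_B 0) (h.indepFun_V_B 0),
    lst_uniform (h.measurable_V 0) (h.law_V 0), lst_uniform (h.measurable_V 0) (h.law_V 0)] at key
  rw [mul_comm (lst P (B 0) lam), mul_comm (lst P (B 0) s), ← key, reflectedOperator,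
    integral_map hm.aemeasurable (Continuous.aestronglyMeasurable (by fun_prop))]
  -- The truncation in the test function is redundant after the reflection.
  simp only [max_eq_left (le_max_right _ (0 : ℝ)), add_sub_assoc]

/-- Invariance is tested on truncated exponentials. The coefficient of `s` is the transform of `V W
+ B` at `λ`; that it is the atom at 0 is shown afterwards. -/
theorem stationary_equation (h : IsUniformExpInput P lam V A B) (hlam : 0 < lam) {π : Measure ℝ}
    [IsProbabilityMeasure π] (hπ : ∀ᵐ x ∂π, 0 ≤ x)
    (hstat : ∀ (f : ℝ → ℝ) (L : ℝ≥0) (C : ℝ), LipschitzWith L f → (∀ x, |f x| ≤ C) →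
      ∫ x, f x ∂π =
        ∫ x, reflectedOperator (P.map fun ω => (V 0 ω, B 0 ω - A 0 ω)) f x ∂π)
    {s : ℝ} (hs : 0 < s) (hne : s ≠ lam) :
    (s - lam) * lst π id s = s * (lst P (B 0) lam * ((∫ u in (0 : ℝ)..lam, lst π id u) / lam)) -
      lam * lst P (B 0) s / s * ∫ u in (0 : ℝ)..s, lst π id u := by
  have hint : ∀ {c : ℝ}, 0 < c →
      Integrable (fun x => ∫ v in (0 : ℝ)..1, Real.exp (-(c * x * v))) π := by
    intro c hc
    refine Integrable.of_bound (Continuous.aestronglyMeasurable ?_) 1 ?_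
    · exact intervalIntegral.continuous_parametric_intervalIntegral_of_continuous'
        (by fun_prop) 0 1
    · filter_upwards [hπ] with x hx
      have := intervalIntegral.norm_integral_le_of_norm_le_const (a := 0) (b := 1) (C := 1)
        (f := fun v => Real.exp (-(c * x * v))) fun v hv => by
          rw [uIoc_of_le zero_le_one] at hv
          rw [Real.norm_eq_abs, Real.abs_exp, Real.exp_le_one_iff]
          exact neg_nonpos.2 (mul_nonneg (mul_nonneg hc.le hx) hv.1.le)
      simpa using this
  have h1 := hstat _ _ 1 (lipschitzWith_exp_neg_mul_max hs.le) fun x => by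
    rw [Real.abs_exp, Real.exp_le_one_iff]
    exact neg_nonpos.2 (mul_nonneg hs.le (le_max_right _ _))
  have h2 : ∫ x, Real.exp (-(s * max x 0)) ∂π = lst π id s := by
    refine integral_congr_ae ?_
    filter_upwards [hπ] with x hx
    rw [max_eq_left hx, id]
  rw [h2, integral_congr_ae (hπ.mono fun x hx => h.reflectedOperator_exp hlam hs hne hx),
    integral_div, integral_sub (((hint hlam).const_mul _).const_mul _)
      (((hint hs).const_mul _).const_mul _), integral_const_mul, integral_const_mul,
    integral_const_mul, integral_const_mul, integral_integral_exp_neg_mul hπ hlam,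
    integral_integral_exp_neg_mul hπ hs, eq_div_iff (sub_ne_zero.2 hne)] at h1
  rw [mul_comm, h1]
  ring

end IsUniformExpInput

/-! ### Identifying the limit law and its atom. -/

theorem ae_nonneg_of_tendstoInDistribution {Ω : Type*} [MeasurableSpace Ω] {P : Measure Ω}
    [IsProbabilityMeasure P] {W : ℕ → Ω → ℝ} {π : Measure ℝ} [IsProbabilityMeasure π]
    (hW : ∀ n, 0 ≤ᵐ[P] W n)
    (h : TendstoInDistribution W atTop (id : ℝ → ℝ) (fun _ => P) π) : ∀ᵐ x ∂π, 0 ≤ x := by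
  have hle := ProbabilityMeasure.limsup_measure_closed_le_of_tendsto h.tendsto
    (isClosed_Ici (a := (0 : ℝ)))
  have hone : ∀ n, (P.map (W n)) (Ici 0) = 1 := fun n => by
    rw [Measure.map_apply_of_aemeasurable (h.forall_aemeasurable n) measurableSet_Ici]
    exact (measure_congr (eventuallyEq_univ.2 (hW n))).trans measure_univ
  simp only [ProbabilityMeasure.coe_mk, hone, limsup_const, Measure.map_id] at hle
  have h1 : π (Ici 0) = 1 := le_antisymm prob_le_one hle
  exact (prob_compl_eq_zero_iff measurableSet_Ici).2 h1

/-- The parameter of the stationary functional equation is the atom of the law at zero. -/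
theorem IsStationaryTransform.eq_atom {lam p : ℝ} {β : ℝ → ℝ} {π : Measure ℝ}
    [IsProbabilityMeasure π] (hπ : ∀ᵐ x ∂π, 0 ≤ x)
    (h : IsStationaryTransform lam p β (lst π id)) (hβ : ∀ s, 0 < s → β s ≤ 1) :
    π.real {0} = p := by
  have hlim : Tendsto (lst π id) atTop (𝓝 (π.real {0})) := by
    simpa using tendsto_lst_atTop (X := id) measurable_id hπ
  have hinv := tendsto_inv_atTop_zero (𝕜 := ℝ)
  have h1 : Tendsto (fun s => (1 - lam * s⁻¹) * lst π id s) atTop (𝓝 (π.real {0})) := by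
    simpa using ((hinv.const_mul lam).const_sub 1).mul hlim
  refine tendsto_nhds_unique h1 ?_
  rw [tendsto_iff_norm_sub_tendsto_zero]
  have hb : Tendsto (fun s : ℝ => lam * s⁻¹) atTop (𝓝 0) := by simpa using hinv.const_mul lam
  refine squeeze_zero' (Eventually.of_forall fun _ => norm_nonneg _) ?_ hb
  filter_upwards [eventually_gt_atTop lam] with s hs
  have hs0 : 0 < s := h.lam_pos.trans hs
  have heq := h.equation s hs0 hs.ne'
  set F := ∫ u in (0 : ℝ)..s, lst π id u
  have hF0 : 0 ≤ F := intervalIntegral.integral_nonneg hs0.le fun u hu =>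
    (lst_pos measurable_id hπ hu.1).le
  have hF1 : F ≤ s := by
    have : F ≤ ∫ _ in (0 : ℝ)..s, (1 : ℝ) :=
      intervalIntegral.integral_mono_on hs0.le (h.intervalIntegrable_φ hs0.le) (by simp)
        fun u hu => lst_le_one hπ hu.1
    simpa using this
  -- This is the functional equation divided by `s`. Since `β s ≤ 1` and `F ≤ s`, the error is at
  -- most `λ / s`.
  have hdiff : (1 - lam * s⁻¹) * lst π id s - p = -(lam * s⁻¹ * (β s * (F / s))) := by
    have : (1 - lam * s⁻¹) * lst π id s = (s - lam) * lst π id s / s := by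
      field_simp
    rw [this, heq]
    field_simp
    ring
  rw [hdiff, norm_neg, Real.norm_eq_abs]
  have hlam := h.lam_pos
  have hβ0 := h.β_pos s hs0
  rw [abs_of_nonneg (by positivity)]
  refine mul_le_of_le_one_right (by positivity) ?_
  exact mul_le_one₀ (hβ s hs0) (by positivity) ((div_le_one hs0).2 hF1)

theorem IsUniformExpInput.isStationaryTransform {Ω : Type*} [MeasurableSpace Ω] {P : Measure Ω}
    [IsProbabilityMeasure P] {lam : ℝ} {V A B : ℕ → Ω → ℝ}
    (h : IsUniformExpInput P lam V A B) (hlam : 0 < lam) {π : Measure ℝ}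
    [IsProbabilityMeasure π] (hπ : ∀ᵐ x ∂π, 0 ≤ x)
    (hstat : ∀ (f : ℝ → ℝ) (L : ℝ≥0) (C : ℝ), LipschitzWith L f → (∀ x, |f x| ≤ C) →
      ∫ x, f x ∂π =
        ∫ x, reflectedOperator (P.map fun ω => (V 0 ω, B 0 ω - A 0 ω)) f x ∂π) :
    IsStationaryTransform lam (π.real {0}) (lst P (B 0)) (lst π id) := by
  have hφ : ContinuousOn (lst π id) (Ici 0) := continuousOn_lst measurable_id hπ
  have hB := h.measurable_B 0
  have hB0 := h.nonneg_B 0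
  -- The explicit coefficient is used first because its positivity is immediate; positivity of the
  -- atom follows once the two are identified.
  have hst : IsStationaryTransform lam
      (lst P (B 0) lam * ((∫ u in (0 : ℝ)..lam, lst π id u) / lam)) (lst P (B 0)) (lst π id) :=
    { lam_pos := hlam
      p_pos := by
        refine mul_pos (lst_pos hB hB0 hlam.le) (div_pos ?_ hlam)
        refine intervalIntegral.intervalIntegral_pos_of_pos_on ?_
          (fun u hu => lst_pos measurable_id hπ hu.1.le) hlam
        refine (hφ.mono ?_).intervalIntegrable
        rw [uIcc_of_le hlam.le]
        exact Icc_subset_Ici_self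
      continuousOn_β := (continuousOn_lst hB hB0).mono Ioi_subset_Ici_self
      β_pos := fun t ht => lst_pos hB hB0 ht.le
      exists_β_bound := ⟨_, fun t ht => abs_lst_sub_one_le hB hB0 h.integrable_B ht.le⟩
      continuousOn_φ := hφ
      φ_zero := lst_zero
      equation := fun s hs hne => h.stationary_equation hlam hπ hstat hs hne }
  rwa [hst.eq_atom hπ fun s hs => lst_le_one hB0 hs.le]

theorem theorem8 {Ω : Type*} [MeasurableSpace Ω] (P : Measure Ω) [IsProbabilityMeasure P]
    (lam : ℝ) (hlam : 0 < lam) (w : ℝ) (hw : 0 ≤ w) (V A B : ℕ → Ω → ℝ)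
    (hinput : IsUniformExpInput P lam V A B) :
    ∃ (π : Measure ℝ) (_ : IsProbabilityMeasure π),
      -- `π` is the law of the proper, nonnegative weak limit `W`
      (∀ᵐ x ∂π, 0 ≤ x) ∧
      TendstoInDistribution (reflectedProcess w V (fun i ω => B i ω - A i ω)) atTop
        (id : ℝ → ℝ) (fun _ => P) π ∧
      -- the Laplace-Stieltjes transform of `W`, all integrals being convergent
      (∀ s : ℝ, 0 < s → s ≠ lam →
        (∀ u ∈ uIcc lam s, u ≠ lam → IntervalIntegrable
          (fun t => lst P (B 0) t / (t * (lam - t))) volume u s) ∧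
        IntervalIntegrable (fun u => u / (u - lam) *
          Real.exp (lam * ∫ t in u..s, lst P (B 0) t / (t * (lam - t)))) volume lam s ∧
        lst π id s = π.real {0} / (s - lam) *
          (s - lam * lst P (B 0) s / s *
            ∫ u in lam..s, u / (u - lam) *
              Real.exp (lam * ∫ t in u..s, lst P (B 0) t / (t * (lam - t))))) ∧
      -- the atom `P(W = 0)`, all integrals being convergent
      (∀ u ∈ Ioo 0 lam, IntervalIntegrable
        (fun t => lam * lst P (B 0) t / (t * (lam - t)) - 1 / t) volume 0 u) ∧
      IntervalIntegrable (fun u => 1 / (lam - u) *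
        Real.exp (-∫ t in (0 : ℝ)..u, (lam * lst P (B 0) t / (t * (lam - t)) - 1 / t)))
        volume 0 lam ∧
      0 < (∫ u in (0 : ℝ)..lam, 1 / (lam - u) *
        Real.exp (-∫ t in (0 : ℝ)..u, (lam * lst P (B 0) t / (t * (lam - t)) - 1 / t))) ∧
      π.real {0} = (∫ u in (0 : ℝ)..lam, 1 / (lam - u) *
        Real.exp (-∫ t in (0 : ℝ)..u, (lam * lst P (B 0) t / (t * (lam - t)) - 1 / t)))⁻¹ := by

  have hchain := hinput.isReflectedInput hlam w
  obtain ⟨π, hπ, hlim, hstat⟩ := hchain.exists_stationary_limit (by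
    rw [← NNReal.coe_lt_coe]; norm_num)
  have hnonneg : ∀ᵐ x ∂π, 0 ≤ x := ae_nonneg_of_tendstoInDistribution
    (fun n => Eventually.of_forall fun ω => reflectedProcess_nonneg hw n ω) hlim
  have hst := hinput.isStationaryTransform hlam hnonneg hstat
  obtain ⟨hint, hmul⟩ := hst.integrable_and_atom_mul_eq
  refine ⟨π, hπ, hnonneg, hlim, fun s hs hne => ⟨fun u hu hune =>
    hst.intervalIntegrable_kernel_of_mem_uIcc hs hne hu hune,
    (hst.integrable_and_primitive_eq hs hne).1, hst.transform_eq hs hne⟩,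
    fun u hu => hst.intervalIntegrable_regularizedKernel hu, hint,
    pos_of_mul_pos_right (by rw [hmul]; exact one_pos) hst.p_pos.le, eq_inv_of_mul_eq_one_left hmul⟩
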